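/- Let $n,r\ge 0$ be integers. Let $\Lambda(n,r)$ be the set of $\lambda\in\mathbb Z_{\ge0}^n$ with $\sum_i\lambda_i=r$, and let $M_n(r)$ be the set of $n\times n$ matrices of nonnegative integers with entry sum $r$; $\mathrm{ro}(A)$ and $\mathrm{co}(A)$ are the vectors of row and column sums of $A$. **Schur algebra.** Let $H_r(q)$ be the Hecke algebra of $\mathfrak S_r$ over $\mathbb Z[q]$, with generators $T_1,\dots,T_{r-1}$, braid relations and $T_i^2=(q-1)T_i+q$; let $T_w=T_{i_1}\cdots T_{i_t}$ for a reduced expression $w=s_{i_1}\cdots s_{i_t}$, and $x_\lambda=\sum_{w\in\mathfrak S_\lambda}T_w$, where $\mathfrak S_\lambda$ is the Young subgroup of $\lambda$. Put $S_q(n,r)=\operatorname{End}_{H_r(q)}\bigl(\bigoplus_{\lambda\in\Lambda(n,r)}x_\lambda H_r(q)\bigr)$ (right modules) and $\mathbf S_0(n,r)=\mathbb C\otimes_{\mathbb Z[q]}S_q(n,r)$, where $q$ acts on $\mathbb C$ by $0$. For $A\in M_n(r)$ with $\lambda=\mathrm{ro}(A)$, $\mu=\mathrm{co}(A)$, let $D_A$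 be the $(\mathfrak S_\lambda,\mathfrak S_\mu)$-double coset of all $w\in\mathfrak S_r$ with $a_{ij}=|R_i^\lambda\cap wR_j^\mu|$, where $R_i^\lambda=\{\lambda_1+\dots+\lambda_{i-1}+1,\dots,\lambda_1+\dots+\lambda_i\}$. There is a unique element of $S_q(n,r)$ with $x_\nu h\mapsto\delta_{\mu\nu}\bigl(\sum_{w\in D_A}T_w\bigr)h\in x_\lambda H_r(q)$; let $e_A\in\mathbf S_0(n,r)$ be its image. Let $D_\lambda=\operatorname{diag}(\lambda_1,\dots,\lambda_n)$ and let $E_{ab}$ be the matrix units. Put $k_\lambda=e_{D_\lambda}$ and, for $1\le i\le n-1$, $$e_i=\sum_{\lambda\in\Lambda(n,r)}e_{D_\lambda-E_{i+1,i+1}+E_{i,i+1}},\qquad f_i=\sum_{\lambda\in\Lambda(n,r)}e_{D_\lambda-E_{i,i}+E_{i+1,i}},$$ where a term whose matrix has a negative entry is $0$. **Tensor space.** Let $\mathbf H_r(0)$ be the $0$-Hecke algebra over $\mathbb C$ with generators $\bar\pi_i$ (braid relations and $\bar\pi_i^2=-\bar\pi_i$), and let $\bar x_\lambda=\sum_{w\in\mathfrak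 S_\lambda}\bar\pi_w$. Let $V_0=\mathbb C^n$ with standard basis $\bar\xi_1,\dots,\bar\xi_n$. The algebra $\mathbf H_r(0)$ acts from the right on $V_0^{\otimes r}$: for $\mathbf v=\bar\xi_{k_1}\otimes\cdots\otimes\bar\xi_{k_r}$, the vector $\mathbf v\bar\pi_i$ is $\mathbf v$ with its $i$-th and $(i+1)$-st factors interchanged if $k_i<k_{i+1}$, it is $0$ if $k_i=k_{i+1}$, and it is $-\mathbf v$ if $k_i>k_{i+1}$. Specialization at $q=0$ induces a $\mathbb C$-algebra isomorphism $\mathbf S_0(n,r)\cong\operatorname{End}_{\mathbf H_r(0)}\bigl(\bigoplus_\lambda\bar x_\lambda\mathbf H_r(0)\bigr)$, and there is an isomorphism of right $\mathbf H_r(0)$-modules $\bigoplus_\lambda\bar x_\lambda\mathbf H_r(0)\cong V_0^{\otimes r}$ with $\bar x_\lambda\mapsto\bar\xi_1^{\otimes\lambda_1}\otimes\cdots\otimes\bar\xi_n^{\otimes\lambda_n}$. Together they identify $\mathbf S_0(n,r)$ with $\operatorname{End}_{\mathbf H_r(0)}(V_0^{\otimes r})$. **Degenerate quantum group.** Let $U_0(\mathfrak{gl}_n)$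 be the unital $\mathbb C$-algebra generated by $\mathbf e_i,\mathbf f_i$ $(1\le i\le n-1)$ and $\mathbf k_i$ $(1\le i\le n)$ with the relations $\mathbf k_i\mathbf k_j=\mathbf k_j\mathbf k_i$; $\mathbf e_i\mathbf k_{i+1}=\mathbf k_i\mathbf e_i=\mathbf k_{i+1}\mathbf f_i=\mathbf f_i\mathbf k_i=0$; $\mathbf k_i\mathbf e_j=\mathbf e_j\mathbf k_i$ and $\mathbf k_i\mathbf f_j=\mathbf f_j\mathbf k_i$ for $j\ne i-1,i$; $[\mathbf e_i,\mathbf f_j]=\delta_{ij}(\mathbf k_{i+1}-\mathbf k_i)$; $[\mathbf e_i,\mathbf e_j]=[\mathbf f_i,\mathbf f_j]=0$ for $|i-j|>1$; and, for $1\le i\le n-2$, $\mathbf e_i^2\mathbf e_{i+1}=\mathbf e_i\mathbf e_{i+1}\mathbf e_i$, $\mathbf e_i\mathbf e_{i+1}^2=\mathbf e_{i+1}\mathbf e_i\mathbf e_{i+1}$, $\mathbf f_{i+1}\mathbf f_i^2=\mathbf f_i\mathbf f_{i+1}\mathbf f_i$, $\mathbf f_{i+1}^2\mathbf f_i=\mathbf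 f_{i+1}\mathbf f_i\mathbf f_{i+1}$, $\mathbf e_i\mathbf e_{i+1}\mathbf k_{i+1}=\mathbf k_{i+1}\mathbf e_i\mathbf e_{i+1}$, $\mathbf f_{i+1}\mathbf f_i\mathbf k_{i+1}=\mathbf k_{i+1}\mathbf f_{i+1}\mathbf f_i$. It is a bialgebra with $\Delta(\mathbf e_i)=1\otimes\mathbf e_i+\mathbf e_i\otimes\mathbf k_i$, $\Delta(\mathbf f_i)=\mathbf k_{i+1}\otimes\mathbf f_i+\mathbf f_i\otimes1$, $\Delta(\mathbf k_i)=\mathbf k_i\otimes\mathbf k_i$, $\epsilon(\mathbf e_i)=\epsilon(\mathbf f_i)=0$, $\epsilon(\mathbf k_i)=1$. It acts on $V_0$ by $\mathbf e_i\mapsto E_{i,i+1}$, $\mathbf f_i\mapsto E_{i+1,i}$, $\mathbf k_i\mapsto\sum_{j\ne i}E_{jj}$, and on $V_0^{\otimes r}$ through the comultiplication (through $\epsilon$ if $r=0$). **Statement.** The action of $U_0(\mathfrak{gl}_n)$ on $V_0^{\otimes r}$ commutes with that of $\mathbf H_r(0)$, and the induced algebra homomorphism $\psi_{n,r}:U_0(\mathfrak{gl}_n)\to\operatorname{End}_{\mathbf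 H_r(0)}(V_0^{\otimes r})\cong\mathbf S_0(n,r)$ satisfies $$\psi_{n,r}(\mathbf e_i)=e_i,\quad \psi_{n,r}(\mathbf f_i)=f_i\quad(1\le i\le n-1),\qquad \psi_{n,r}(\mathbf k_i)=\sum_{\mu\in\Lambda(n,r),\ \mu_i=0}k_\mu\quad(1\le i\le n).$$ -/

import Mathlib

open scoped TensorProduct DirectSum

noncomputable section

namespace ZeroSchur

/-! ### Indices, weak compositions, matrices, Young subgroups -/

/-- The pairs `(i, i+1)` of adjacent elements of `Fin m` (there are `m - 1` of them). -/
abbrev Adj (m : ℕ) : Type := {i : ℕ // i + 1 < m}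

/-- The left element of an adjacent pair. -/
def Adj.lo {m : ℕ} (i : Adj m) : Fin m := ⟨i.1, Nat.lt_of_succ_lt i.2⟩

/-- The right element of an adjacent pair. -/
def Adj.hi {m : ℕ} (i : Adj m) : Fin m := ⟨i.1 + 1, i.2⟩

/-- `Λ(n, r)`: the weak compositions of `r` with `n` parts. -/
abbrev WComp (n r : ℕ) : Type := {l : Fin n → ℕ // ∑ i, l i = r}

instance (n r : ℕ) : Fintype (WComp n r) :=
  Fintype.subtype (Finset.piAntidiag Finset.univ r) (by simp)

/-- `M_n(r)`: the `n × n` matrices of nonnegative integers with entry sum `r`. -/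
abbrev NMat (n r : ℕ) : Type := {A : Matrix (Fin n) (Fin n) ℕ // ∑ i, ∑ j, A i j = r}

/-- The vector of row sums. -/
def ro {n r : ℕ} (A : NMat n r) : WComp n r := ⟨fun i => ∑ j, A.1 i j, A.2⟩

/-- The vector of column sums. -/
def co {n r : ℕ} (A : NMat n r) : WComp n r :=
  ⟨fun j => ∑ i, A.1 i j, by rw [Finset.sum_comm]; exact A.2⟩

/-- The weakly increasing word `1 ⋯ 1 2 ⋯ 2 ⋯ n ⋯ n` in which the letter `i` occurs `l i` times. -/
def iword {n r : ℕ} (l : WComp n r) (p : Fin r) : Fin n :=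
  (finSigmaFinEquiv.symm (Fin.cast l.2.symm p)).1

/-- The `i`-th block `R_i` of consecutive positions (of size `l i`) of a weak composition. -/
def block {n r : ℕ} (l : WComp n r) (i : Fin n) : Finset (Fin r) :=
  Finset.univ.filter fun p => iword l p = i

/-- The Young subgroup: the permutations that preserve each block. -/
def young {n r : ℕ} (l : WComp n r) : Subgroup (Equiv.Perm (Fin r)) where
  carrier := {w | ∀ p, iword l (w p) = iword l p}
  mul_mem' := by
    intro a b ha hb p
    rw [Equiv.Perm.mul_apply, ha, hb]
  one_mem' := by intro p; rfl
  inv_mem' := by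
    intro a ha p
    have h := ha (a⁻¹ p)
    simpa using h.symm

/-- The matrix with entries `|R_i^l ∩ w R_j^m|`. -/
def relPos {n r : ℕ} (l m : WComp n r) (w : Equiv.Perm (Fin r)) : Matrix (Fin n) (Fin n) ℕ :=
  fun i j => (block l i ∩ (block m j).map w.toEmbedding).card

/-- The double coset of `young (ro A)` and `young (co A)` that corresponds to `A`: the permutations
`w` with `A i j = |R_i ∩ w R_j|`, where `R_i`, `R_j` are the blocks of `ro A` and `co A`
(see `coset_eq_doubleCoset`). -/
def coset {n r : ℕ} (A : NMat n r) : Set (Equiv.Perm (Fin r)) :=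
  {w | relPos (ro A) (co A) w = A.1}

theorem mem_coset_iff {n r : ℕ} (A : NMat n r) (w : Equiv.Perm (Fin r)) :
    w ∈ coset A ↔ ∀ i j, (Finset.univ.filter fun p =>
      iword (ro A) p = i ∧ iword (co A) (w⁻¹ p) = j).card = A.1 i j := by
  have h : ∀ i j, block (ro A) i ∩ (block (co A) j).map w.toEmbedding =
      Finset.univ.filter fun p => iword (ro A) p = i ∧ iword (co A) (w⁻¹ p) = j := by
    intro i j
    ext p
    simp only [block, Finset.mem_inter, Finset.mem_filter, Finset.mem_univ, true_and,
      Finset.mem_map_equiv]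
    rfl
  simp only [coset, Set.mem_ofPred_eq, ← Matrix.ext_iff, relPos, h]

theorem coset_eq_doubleCoset {n r : ℕ} (A : NMat n r) (w : Equiv.Perm (Fin r)) (hw : w ∈ coset A) :
    coset A = DoubleCoset.doubleCoset w (young (ro A)) (young (co A)) := by
  ext w'
  rw [DoubleCoset.mem_doubleCoset]
  constructor
  · intro hw'
    rw [mem_coset_iff] at hw hw'
    have hcard : ∀ c : Fin n × Fin n,
        Nonempty ({p // (iword (ro A) p, iword (co A) (w⁻¹ p)) = c} ≃
          {p // (iword (ro A) p, iword (co A) (w'⁻¹ p)) = c}) := by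
      rintro ⟨i, j⟩
      rw [← Fintype.card_eq, Fintype.card_subtype, Fintype.card_subtype]
      simpa only [Prod.mk.injEq] using (hw i j).trans (hw' i j).symm
    let E := fun c => (hcard c).some
    let u : Equiv.Perm (Fin r) :=
      (Equiv.sigmaFiberEquiv fun p => (iword (ro A) p, iword (co A) (w⁻¹ p))).symm.trans
        ((Equiv.sigmaCongrRight E).trans
          (Equiv.sigmaFiberEquiv fun p => (iword (ro A) p, iword (co A) (w'⁻¹ p))))
    have hu : ∀ p, (iword (ro A) (u p), iword (co A) (w'⁻¹ (u p))) =
        (iword (ro A) p, iword (co A) (w⁻¹ p)) := fun p =>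
      (E (iword (ro A) p, iword (co A) (w⁻¹ p)) ⟨p, rfl⟩).2
    refine ⟨u, fun p => congrArg Prod.fst (hu p), w⁻¹ * u⁻¹ * w', ?_, by group⟩
    refine (Subgroup.inv_mem_iff _).1 fun p => ?_
    have := congrArg Prod.snd (hu (w p))
    simpa using this
  · rintro ⟨u, hu, v, hv, rfl⟩
    rw [mem_coset_iff] at hw ⊢
    intro i j
    rw [← hw i j]
    refine Finset.card_equiv u⁻¹ fun p => ?_
    have h1 : iword (ro A) (u⁻¹ p) = iword (ro A) p := (young (ro A)).inv_mem hu p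
    have h2 : ∀ x, iword (co A) (v⁻¹ x) = iword (co A) x := (young (co A)).inv_mem hv
    simp only [Finset.mem_filter, Finset.mem_univ, true_and, mul_inv_rev, Equiv.Perm.mul_apply, h1,
      h2]

/-- The simple transposition `s_i = (i, i+1)`. -/
def simpleSwap {r : ℕ} (i : Adj r) : Equiv.Perm (Fin r) := Equiv.swap i.lo i.hi

/-- The words in the simple transpositions of minimal length among those with product `w`. -/
def IsReducedWord {r : ℕ} (w : Equiv.Perm (Fin r)) (L : List (Adj r)) : Prop :=
  (L.map simpleSwap).prod = w ∧
    ∀ L' : List (Adj r), (L'.map simpleSwap).prod = w → L.length ≤ L'.length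

theorem exists_word {r : ℕ} (w : Equiv.Perm (Fin r)) :
    ∃ L : List (Adj r), (L.map simpleSwap).prod = w := by
  rcases r with _ | r
  · exact ⟨[], Subsingleton.elim _ _⟩
  · have hw : w ∈ Submonoid.closure
        (Set.range fun i : Fin r => Equiv.swap i.castSucc i.succ) := by
      rw [Equiv.Perm.mclosure_swap_castSucc_succ]; trivial
    induction hw using Submonoid.closure_induction with
    | mem x hx =>
      obtain ⟨i, rfl⟩ := hx
      refine ⟨[⟨i.1, by omega⟩], ?_⟩
      simp only [List.map_cons, List.map_nil, List.prod_cons, List.prod_nil, mul_one]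
      rfl
    | one => exact ⟨[], rfl⟩
    | mul x y _ _ hx hy =>
      obtain ⟨L, rfl⟩ := hx
      obtain ⟨L', rfl⟩ := hy
      exact ⟨L ++ L', by simp⟩

theorem exists_reducedWord {r : ℕ} (w : Equiv.Perm (Fin r)) :
    ∃ L : List (Adj r), IsReducedWord w L := by
  classical
  have h : ∃ k : ℕ, ∃ L : List (Adj r), (L.map simpleSwap).prod = w ∧ L.length = k := by
    obtain ⟨L, hL⟩ := exists_word w
    exact ⟨_, L, hL, rfl⟩
  obtain ⟨L, hL, hk⟩ := Nat.find_spec h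
  exact ⟨L, hL, fun L' hL' => hk ▸ Nat.find_min' h ⟨L', hL', rfl⟩⟩

/-- A chosen reduced expression of `w`. -/
def reducedWord {r : ℕ} (w : Equiv.Perm (Fin r)) : List (Adj r) := (exists_reducedWord w).choose

/-! ### Hecke algebras of type A -/

section Hecke

variable (R : Type) [CommRing R] (q : R)

/-- The defining relations of the Hecke algebra. -/
inductive HeckeRel (r : ℕ) : FreeAlgebra R (Adj r) → FreeAlgebra R (Adj r) → Prop
  | quad (i : Adj r) : HeckeRel r (FreeAlgebra.ι R i * FreeAlgebra.ι R i)
      ((q - 1) • FreeAlgebra.ι R i + algebraMap R _ q)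
  | comm (i j : Adj r) (h : i.1 + 1 < j.1 ∨ j.1 + 1 < i.1) :
      HeckeRel r (FreeAlgebra.ι R i * FreeAlgebra.ι R j) (FreeAlgebra.ι R j * FreeAlgebra.ι R i)
  | braid (i j : Adj r) (h : j.1 = i.1 + 1) :
      HeckeRel r (FreeAlgebra.ι R i * FreeAlgebra.ι R j * FreeAlgebra.ι R i)
        (FreeAlgebra.ι R j * FreeAlgebra.ι R i * FreeAlgebra.ι R j)

/-- The Hecke algebra of the symmetric group on `r` letters over `R` with parameter `q`.
`Hecke ℤ[X] X r` is the generic Hecke algebra, and `Hecke ℂ 0 r` is the `0`-Hecke algebra. -/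
def Hecke (r : ℕ) : Type := RingQuot (HeckeRel R q r)

instance (r : ℕ) : Ring (Hecke R q r) := inferInstanceAs (Ring (RingQuot (HeckeRel R q r)))

instance (r : ℕ) : Algebra R (Hecke R q r) :=
  inferInstanceAs (Algebra R (RingQuot (HeckeRel R q r)))

variable {n r : ℕ}

/-- The generators `T_i` (written `π̄_i` for `q = 0`). -/
def Hecke.T (i : Adj r) : Hecke R q r :=
  RingQuot.mkAlgHom R (HeckeRel R q r) (FreeAlgebra.ι R i)

/-- `T_w = T_{i_1} ⋯ T_{i_t}` for a reduced expression `w = s_{i_1} ⋯ s_{i_t}`. -/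
def Hecke.Tw (w : Equiv.Perm (Fin r)) : Hecke R q r := ((reducedWord w).map (Hecke.T R q)).prod

open Classical in
/-- `x_l`, the sum of the `T_w` over the Young subgroup of `l`. -/
def xsum (l : WComp n r) : Hecke R q r :=
  ∑ w ∈ Finset.univ.filter (fun w => w ∈ young l), Hecke.Tw R q w

open Classical in
/-- The sum of the `T_w` over the double coset that corresponds to `A`. -/
def cosetSum (A : NMat n r) : Hecke R q r :=
  ∑ w ∈ Finset.univ.filter (fun w => w ∈ coset A), Hecke.Tw R q w

/-- The right ideal `x_l H`. -/
abbrev xH (l : WComp n r) : Submodule (Hecke R q r)ᵐᵒᵖ (Hecke R q r) :=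
  Submodule.span _ {xsum R q l}

variable (n r)

/-- The right `H`-module `⨁ x_l H`, the sum over all `l ∈ Λ(n, r)`. -/
abbrev PermMod : Type := ⨁ l : WComp n r, xH R q l

/-- The endomorphism algebra of the right `H`-module `⨁ x_l H`; for `R = ℤ[X]` and `q = X` this is
the `q`-Schur algebra. -/
abbrev Schur : Type := Module.End (Hecke R q r)ᵐᵒᵖ (PermMod R q n r)

variable {n r}

/-- The element `x_l` of the summand `x_l H`. -/
def gen (l : WComp n r) : PermMod R q n r :=
  DirectSum.of (fun l : WComp n r => xH R q l) l
    ⟨xsum R q l, Submodule.subset_span (Set.mem_singleton _)⟩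

/-- `φ` is the endomorphism `x_ν h ↦ δ_{ν, co A} X h` with values in the summand indexed by `ro A`,
where `X` is the sum of the `T_w` over the double coset that corresponds to `A`. -/
def IsStd (A : NMat n r) (φ : Schur R q n r) : Prop :=
  ∀ ν κ : WComp n r, ((φ (gen R q ν) κ : xH R q κ) : Hecke R q r) =
    if ν = co A ∧ κ = ro A then cosetSum R q A else 0

open Classical in
/-- The standard basis element of the Schur algebra that corresponds to `A`. (It exists, and it is
unique because the elements `gen ν` generate the module.) -/
def std (A : NMat n r) : Schur R q n r :=
  if h : ∃ φ, IsStd R q A φ then h.choose else 0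

/-! ### The right action of the Hecke algebra on tensor space -/

variable (n r) in
/-- The tensor space `(R^n)^{⊗ r}`. -/
abbrev TSpace : Type := TensorPower R r (Fin n → R)

/-- The basis `ξ_{k_1} ⊗ ⋯ ⊗ ξ_{k_r}` of the tensor space, indexed by words. -/
def ξ : Module.Basis (Fin r → Fin n) R (TSpace R n r) :=
  Basis.piTensorProduct fun _ => Pi.basisFun R (Fin n)

/-- The right action of the generator `T_i` on the tensor space. -/
def actT (i : Adj r) : Module.End R (TSpace R n r) :=
  (ξ R).constr R fun k =>
    if k i.lo < k i.hi then ξ R (k ∘ simpleSwap i)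
    else if k i.lo = k i.hi then q • ξ R k
    else q • ξ R (k ∘ simpleSwap i) + (q - 1) • ξ R k

theorem actT_ξ (i : Adj r) (k : Fin r → Fin n) : actT R q i (ξ R k) =
    if k i.lo < k i.hi then ξ R (k ∘ simpleSwap i)
    else if k i.lo = k i.hi then q • ξ R k
    else q • ξ R (k ∘ simpleSwap i) + (q - 1) • ξ R k := by
  simp only [actT, Module.Basis.constr_basis]

theorem actT_quad (i : Adj r) : actT R q (n := n) i * actT R q i =
    (q - 1) • actT R q i + algebraMap R _ q := by
  refine (ξ R).ext fun k => ?_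
  have h1 : (k ∘ simpleSwap i) i.lo = k i.hi := by simp [simpleSwap]
  have h2 : (k ∘ simpleSwap i) i.hi = k i.lo := by simp [simpleSwap]
  have h3 : (k ∘ simpleSwap i) ∘ simpleSwap i = k := by
    funext p; simp [simpleSwap]
  simp only [Module.End.mul_apply, LinearMap.add_apply, LinearMap.smul_apply, Module.algebraMap_end_apply,
    actT_ξ]
  rcases lt_trichotomy (k i.lo) (k i.hi) with h | h | h
  · rw [if_pos h, actT_ξ, h1, h2, h3, if_neg (not_lt.2 h.le), if_neg h.ne']
    module
  · rw [if_neg h.not_lt, if_pos h, map_smul, actT_ξ, if_neg h.not_lt, if_pos h]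
    module
  · rw [if_neg (not_lt.2 h.le), if_neg h.ne', map_add, map_smul, map_smul, actT_ξ, actT_ξ, h1, h2, h3,
      if_pos h, if_neg (not_lt.2 h.le), if_neg h.ne']
    module

theorem actT_comm (i j : Adj r) (h : i.1 + 1 < j.1 ∨ j.1 + 1 < i.1) :
    actT R q (n := n) i * actT R q j = actT R q j * actT R q i := by
  refine (ξ R).ext fun k => ?_
  have hne : i.lo ≠ j.lo ∧ i.lo ≠ j.hi ∧ i.hi ≠ j.lo ∧ i.hi ≠ j.hi := by
    simp only [Adj.lo, Adj.hi, ne_eq, Fin.mk.injEq]; omega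
  obtain ⟨a, b, c, d⟩ := hne
  have h1 : (k ∘ simpleSwap i) j.lo = k j.lo := by
    simp [simpleSwap, Equiv.swap_apply_of_ne_of_ne a.symm c.symm]
  have h2 : (k ∘ simpleSwap i) j.hi = k j.hi := by
    simp [simpleSwap, Equiv.swap_apply_of_ne_of_ne b.symm d.symm]
  have h3 : (k ∘ simpleSwap j) i.lo = k i.lo := by
    simp [simpleSwap, Equiv.swap_apply_of_ne_of_ne a b]
  have h4 : (k ∘ simpleSwap j) i.hi = k i.hi := by
    simp [simpleSwap, Equiv.swap_apply_of_ne_of_ne c d]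
  have h5 : (k ∘ simpleSwap i) ∘ simpleSwap j = (k ∘ simpleSwap j) ∘ simpleSwap i := by
    have : simpleSwap i * simpleSwap j = simpleSwap j * simpleSwap i :=
      (Equiv.Perm.disjoint_swap_swap (by simp [Adj.lo, Adj.hi]; omega)).commute
    funext p
    exact congrArg k (DFunLike.congr_fun this p)
  simp only [Module.End.mul_apply, actT_ξ]
  split_ifs <;> simp only [map_add, map_smul, actT_ξ, lt_self_iff_false, *, if_true, if_false] <;> module

theorem actT_braid (i j : Adj r) (h : j.1 = i.1 + 1) :
    actT R q (n := n) i * actT R q j * actT R q i = actT R q j * actT R q i * actT R q j := by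
  have hm : j.lo = i.hi := by simp [Adj.lo, Adj.hi, h]
  have hab : i.lo ≠ i.hi := by simp [Adj.lo, Adj.hi]
  have hbc : i.hi ≠ j.hi := by simp [Adj.hi, h]
  have hac : i.lo ≠ j.hi := by
    simp only [Adj.lo, Adj.hi, ne_eq, Fin.mk.injEq]
    omega
  have key : simpleSwap i * simpleSwap j * simpleSwap i =
      simpleSwap j * simpleSwap i * simpleSwap j := by
    simp only [simpleSwap, hm]
    rw [Equiv.swap_mul_swap_mul_swap hab hac]
    have h := Equiv.swap_mul_swap_mul_swap hbc.symm hac.symm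
    rw [Equiv.swap_comm i.hi i.lo, Equiv.swap_comm j.hi i.hi] at h
    rw [h, Equiv.swap_comm]
  have E : ∀ k : Fin r → Fin n,
      ((k ∘ simpleSwap i) ∘ simpleSwap j) ∘ simpleSwap i =
      ((k ∘ simpleSwap j) ∘ simpleSwap i) ∘ simpleSwap j := fun k => by
    funext p
    exact congrArg k (DFunLike.congr_fun key p)
  have I1 : ∀ k : Fin r → Fin n, (k ∘ simpleSwap i) i.lo = k i.hi := by simp [simpleSwap]
  have I2 : ∀ k : Fin r → Fin n, (k ∘ simpleSwap i) i.hi = k i.lo := by simp [simpleSwap]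
  have I3 : ∀ k : Fin r → Fin n, (k ∘ simpleSwap i) j.hi = k j.hi := by
    simp [simpleSwap, Equiv.swap_apply_of_ne_of_ne hac.symm hbc.symm]
  have J1 : ∀ k : Fin r → Fin n, (k ∘ simpleSwap j) i.hi = k j.hi := by simp [simpleSwap, hm]
  have J2 : ∀ k : Fin r → Fin n, (k ∘ simpleSwap j) j.hi = k i.hi := by simp [simpleSwap, hm]
  have J3 : ∀ k : Fin r → Fin n, (k ∘ simpleSwap j) i.lo = k i.lo := by
    simp [simpleSwap, hm, Equiv.swap_apply_of_ne_of_ne hab hac]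
  have II : ∀ k : Fin r → Fin n, (k ∘ simpleSwap i) ∘ simpleSwap i = k := by
    intro k; funext p; simp [simpleSwap]
  have JJ : ∀ k : Fin r → Fin n, (k ∘ simpleSwap j) ∘ simpleSwap j = k := by
    intro k; funext p; simp [simpleSwap]
  have Es : ∀ k : Fin r → Fin n, k i.lo = k i.hi → k ∘ simpleSwap i = k := by
    intro k hk
    funext p
    by_cases h1 : p = i.lo
    · simp [simpleSwap, h1, hk]
    by_cases h2 : p = i.hi
    · simp [simpleSwap, h2, hk]
    · simp [simpleSwap, Equiv.swap_apply_of_ne_of_ne h1 h2]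
  have Et : ∀ k : Fin r → Fin n, k i.hi = k j.hi → k ∘ simpleSwap j = k := by
    intro k hk
    funext p
    by_cases h1 : p = i.hi
    · simp [simpleSwap, hm, h1, hk]
    by_cases h2 : p = j.hi
    · simp [simpleSwap, hm, h2, hk]
    · simp [simpleSwap, hm, Equiv.swap_apply_of_ne_of_ne h1 h2]
  refine (ξ R).ext fun k => ?_
  have A1 : k i.lo = k i.hi →
      ((k ∘ simpleSwap j) ∘ simpleSwap i) ∘ simpleSwap j = (k ∘ simpleSwap j) ∘ simpleSwap i := by
    intro h1
    rw [← E, Es k h1]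
  have A2 : k i.lo = k j.hi → (k ∘ simpleSwap i) ∘ simpleSwap j = k ∘ simpleSwap i := by
    intro h1
    exact Et _ (by rw [I2, I3, h1])
  have A3 : k i.lo = k j.hi → (k ∘ simpleSwap j) ∘ simpleSwap i = k ∘ simpleSwap j := by
    intro h1
    exact Es _ (by rw [J1, J3, h1])
  simp only [Module.End.mul_apply]
  rcases lt_trichotomy (k i.lo) (k i.hi) with h1 | h1 | h1 <;>
  rcases lt_trichotomy (k i.hi) (k j.hi) with h2 | h2 | h2 <;>
  rcases lt_trichotomy (k i.lo) (k j.hi) with h3 | h3 | h3 <;>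
  first
  | (exfalso; omega)
  | skip
  all_goals
    have B1 := h1.not_gt
    have B2 := h2.not_gt
    have B3 := h3.not_gt
    first
    | have C1 := h1.ne
    | have C1 := A1 h1
    first
    | have C2 := h2.ne
    | skip
    first
    | have C3 := h3.ne
    | have C3 := A2 h3
    first
    | have D1 := h1.ne'
    | skip
    first
    | have D2 := h2.ne'
    | skip
    first
    | have D3 := h3.ne'
    | skip
    clear h A1 A2 A3 Es Et hab hbc hac key
    simp only [map_add, map_smul, actT_ξ, lt_self_iff_false, if_true, if_false, *]
    try module

/-- The right action of the Hecke algebra on the tensor space. -/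
def heckeAct : Hecke R q r →ₐ[R] (Module.End R (TSpace R n r))ᵐᵒᵖ :=
  RingQuot.liftAlgHom R ⟨FreeAlgebra.lift R fun i => MulOpposite.op (actT R q i), by
    intro x y h
    apply MulOpposite.unop_injective
    induction h with
    | quad i => simpa using actT_quad R q i
    | comm i j h => simpa using (actT_comm R q i j h).symm
    | braid i j h => simpa [mul_assoc] using actT_braid R q i j h⟩

instance : Module (Hecke R q r)ᵐᵒᵖ (TSpace R n r) :=
  Module.compHom _ (AlgHom.opComm (heckeAct R q (n := n) (r := r))).toRingHom

theorem Hecke.rel {x y : FreeAlgebra R (Adj r)} (h : HeckeRel R q r x y) :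
    RingQuot.mkAlgHom R (HeckeRel R q r) x = RingQuot.mkAlgHom R (HeckeRel R q r) y :=
  RingQuot.mkAlgHom_rel R h

theorem Hecke.T_quad (i : Adj r) : Hecke.T R q i * Hecke.T R q i =
    (q - 1) • Hecke.T R q i + algebraMap R _ q := by
  have h := Hecke.rel R q (HeckeRel.quad i)
  rw [map_mul, map_add, map_smul, AlgHom.commutes] at h
  exact h

theorem Hecke.T_comm (i j : Adj r) (hij : i.1 + 1 < j.1 ∨ j.1 + 1 < i.1) :
    Hecke.T R q i * Hecke.T R q j = Hecke.T R q j * Hecke.T R q i := by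
  have h := Hecke.rel R q (HeckeRel.comm i j hij)
  rw [map_mul, map_mul] at h
  exact h

theorem Hecke.T_braid (i j : Adj r) (hij : j.1 = i.1 + 1) :
    Hecke.T R q i * Hecke.T R q j * Hecke.T R q i =
      Hecke.T R q j * Hecke.T R q i * Hecke.T R q j := by
  have h := Hecke.rel R q (HeckeRel.braid i j hij)
  rw [map_mul, map_mul, map_mul, map_mul] at h
  exact h

theorem op_T_smul (i : Adj r) (v : TSpace R n r) :
    MulOpposite.op (Hecke.T R q i) • v = actT R q i v := by
  have h : heckeAct R q (n := n) (Hecke.T R q i) = MulOpposite.op (actT R q i) := by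
    unfold heckeAct Hecke.T
    exact (RingQuot.liftAlgHom_mkAlgHom_apply ..).trans (FreeAlgebra.lift_ι_apply _ _)
  change (heckeAct R q (n := n) (Hecke.T R q i)).unop v = _
  rw [h, MulOpposite.unop_op]

end Hecke

/-! ### Specialization at `q = 0` -/

open Polynomial in
/-- The specialization `ℤ[q] → ℂ`, `q ↦ 0`. -/
def evZero : ℤ[X] →+* ℂ := eval₂RingHom (Int.castRingHom ℂ) 0

open Polynomial in
/-- `ℂ` as an algebra over `ℤ[q]` on which `q` acts by `0`. -/
instance algEvZero : Algebra ℤ[X] ℂ := evZero.toAlgebra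

section Spec

open Polynomial

variable (n r : ℕ)

/-- The `q`-Schur algebra over `ℤ[q]`. -/
abbrev SchurQ : Type := Schur ℤ[X] X n r

/-- The `0`-Schur algebra over `ℂ`. -/
abbrev SchurZero : Type := ℂ ⊗[ℤ[X]] SchurQ n r

variable {n r}

/-- The ring homomorphism from the generic Hecke algebra to the `0`-Hecke algebra that sends `q` to
`0` and `T_i` to `π̄_i`. -/
def specH : Hecke ℤ[X] X r →+* Hecke ℂ 0 r :=
  letI : Algebra ℤ[X] (Hecke ℂ 0 r) :=
    ((algebraMap ℂ (Hecke ℂ 0 r)).comp evZero).toAlgebra' fun c x => Algebra.commutes (evZero c) x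
  (RingQuot.liftAlgHom ℤ[X] ⟨FreeAlgebra.lift ℤ[X] (Hecke.T ℂ 0), by
    intro x y h
    have hX : ∀ p : ℤ[X], algebraMap ℤ[X] (Hecke ℂ 0 r) p = algebraMap ℂ _ (evZero p) :=
      fun _ => rfl
    induction h with
    | quad i =>
      simp only [map_mul, map_add, AlgHom.commutes, FreeAlgebra.lift_ι_apply,
        Hecke.T_quad, Algebra.smul_def, hX]
      simp [evZero]
    | comm i j h => simpa using Hecke.T_comm ℂ 0 i j h
    | braid i j h => simpa using Hecke.T_braid ℂ 0 i j h⟩ :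
    RingQuot (HeckeRel ℤ[X] X r) →ₐ[ℤ[X]] Hecke ℂ 0 r).toRingHom

theorem specH_T (i : Adj r) : specH (Hecke.T ℤ[X] X i) = Hecke.T ℂ 0 i := by
  unfold specH
  let _ : Algebra ℤ[X] (Hecke ℂ 0 r) :=
    ((algebraMap ℂ (Hecke ℂ 0 r)).comp evZero).toAlgebra' fun c x => Algebra.commutes (evZero c) x
  exact (RingQuot.liftAlgHom_mkAlgHom_apply ..).trans (FreeAlgebra.lift_ι_apply _ _)

theorem specH_xsum (l : WComp n r) : specH (xsum ℤ[X] X l) = xsum ℂ 0 l := by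
  simp only [xsum, map_sum, Hecke.Tw, map_list_prod, List.map_map]
  refine Finset.sum_congr rfl fun w _ => ?_
  congr 2
  funext i
  exact specH_T i

theorem specH_mem (l : WComp n r) (x : Hecke ℤ[X] X r) (hx : x ∈ xH ℤ[X] X l) :
    specH x ∈ xH ℂ 0 l := by
  obtain ⟨h, rfl⟩ := Submodule.mem_span_singleton.1 hx
  rw [MulOpposite.smul_eq_mul_unop, map_mul, specH_xsum]
  exact Submodule.mem_span_singleton.2 ⟨MulOpposite.op (specH h.unop), by simp⟩

/-- The specialization `⨁ x_l H_q → ⨁ x_l H_0` at `q = 0`. -/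
def specM : PermMod ℤ[X] X n r →+ PermMod ℂ 0 n r :=
  DirectSum.map fun l =>
    { toFun := fun x => ⟨specH x.1, specH_mem l x.1 x.2⟩
      map_zero' := by ext; simp
      map_add' := fun x y => by ext; simp }

/-- The standard basis element `e_A` of the `0`-Schur algebra. -/
def eA (A : NMat n r) : SchurZero n r := 1 ⊗ₜ std ℤ[X] X A

/-- `k_l = e_{D_l}` with `D_l = diag(l_1, …, l_n)`. -/
def kS (l : WComp n r) : SchurZero n r :=
  eA ⟨Matrix.diagonal l.1, by simp [Matrix.diagonal_apply, l.2]⟩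

/-- The matrix `D_l - E_{b,b} + E_{a,b}`, for `l b > 0`. -/
def moved (l : WComp n r) (a b : Fin n) (h : 0 < l.1 b) : NMat n r :=
  ⟨Matrix.diagonal l.1 - Matrix.single b b 1 + Matrix.single a b 1, by
    have hle : ∀ i j, (Matrix.single b b 1 : Matrix (Fin n) (Fin n) ℕ) i j ≤
        Matrix.diagonal l.1 i j := by
      intro i j
      rw [Matrix.single_apply]
      split_ifs with hij
      · obtain ⟨rfl, rfl⟩ := hij
        rw [Matrix.diagonal_apply_eq]
        exact h
      · exact Nat.zero_le _
    have key : ∀ c : Fin n, ∑ i, ∑ j, (Matrix.single c b 1 : Matrix (Fin n) (Fin n) ℕ) i j = 1 := by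
      intro c
      simp [Matrix.single_apply, ite_and]
    have h1 : ∑ i, ∑ j, ((Matrix.diagonal l.1 - Matrix.single b b 1 : Matrix (Fin n) (Fin n) ℕ) i j
        + (Matrix.single b b 1 : Matrix (Fin n) (Fin n) ℕ) i j) = r := by
      refine Eq.trans (Finset.sum_congr rfl fun i _ => ?_) l.2
      simp only [Matrix.sub_apply, Nat.sub_add_cancel (hle i _)]
      simp [Matrix.diagonal_apply]
    simp only [Finset.sum_add_distrib, key] at h1
    simpa only [Matrix.add_apply, Finset.sum_add_distrib, key] using h1⟩

/-- `e_i`, the sum over `l` of the elements `e_A` with `A = D_l - E_{i+1,i+1} + E_{i,i+1}`, where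
a term is zero if `l (i+1) = 0`, so that `A` has a negative entry. -/
def eS (i : Adj n) : SchurZero n r :=
  ∑ l : WComp n r, if h : 0 < l.1 i.hi then eA (moved l i.lo i.hi h) else 0

/-- `f_i`, the sum over `l` of the elements `e_A` with `A = D_l - E_{i,i} + E_{i+1,i}`, where
a term is zero if `l i = 0`, so that `A` has a negative entry. -/
def fS (i : Adj n) : SchurZero n r :=
  ∑ l : WComp n r, if h : 0 < l.1 i.lo then eA (moved l i.hi i.lo h) else 0

end Spec

/-! ### The degenerate quantum group -/

/-- The generators of `U_0(gl_n)`. -/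
inductive UGen (n : ℕ) : Type
  | e (i : Adj n)
  | f (i : Adj n)
  | k (i : Fin n)

section U

variable {n : ℕ}

/-- The generator `e_i` of the free algebra. -/
def fe (i : Adj n) : FreeAlgebra ℂ (UGen n) := FreeAlgebra.ι ℂ (UGen.e i)

/-- The generator `f_i` of the free algebra. -/
def ff (i : Adj n) : FreeAlgebra ℂ (UGen n) := FreeAlgebra.ι ℂ (UGen.f i)

/-- The generator `k_i` of the free algebra. -/
def fk (i : Fin n) : FreeAlgebra ℂ (UGen n) := FreeAlgebra.ι ℂ (UGen.k i)

/-- The defining relations of `U_0(gl_n)`. -/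
inductive URel : FreeAlgebra ℂ (UGen n) → FreeAlgebra ℂ (UGen n) → Prop
  | kk (i j : Fin n) : URel (fk i * fk j) (fk j * fk i)
  | ek_zero (i : Adj n) : URel (fe i * fk i.hi) 0
  | ke_zero (i : Adj n) : URel (fk i.lo * fe i) 0
  | ke (i : Fin n) (j : Adj n) (h : i ≠ j.lo) (h' : i ≠ j.hi) : URel (fk i * fe j) (fe j * fk i)
  | kf_zero (i : Adj n) : URel (fk i.hi * ff i) 0
  | fk_zero (i : Adj n) : URel (ff i * fk i.lo) 0
  | kf (i : Fin n) (j : Adj n) (h : i ≠ j.lo) (h' : i ≠ j.hi) : URel (fk i * ff j) (ff j * fk i)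
  | ef_same (i : Adj n) : URel (fe i * ff i - ff i * fe i) (fk i.hi - fk i.lo)
  | ef_ne (i j : Adj n) (h : i ≠ j) : URel (fe i * ff j) (ff j * fe i)
  | ee1 (i j : Adj n) (h : j.1 = i.1 + 1) : URel (fe i * fe i * fe j) (fe i * fe j * fe i)
  | ee2 (i j : Adj n) (h : j.1 = i.1 + 1) : URel (fe i * fe j * fe j) (fe j * fe i * fe j)
  | ff1 (i j : Adj n) (h : j.1 = i.1 + 1) : URel (ff j * ff i * ff i) (ff i * ff j * ff i)
  | ff2 (i j : Adj n) (h : j.1 = i.1 + 1) : URel (ff j * ff j * ff i) (ff j * ff i * ff j)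
  | ee_far (i j : Adj n) (h : i.1 + 1 < j.1 ∨ j.1 + 1 < i.1) : URel (fe i * fe j) (fe j * fe i)
  | ff_far (i j : Adj n) (h : i.1 + 1 < j.1 ∨ j.1 + 1 < i.1) : URel (ff i * ff j) (ff j * ff i)
  | eek (i j : Adj n) (h : j.1 = i.1 + 1) :
      URel (fe i * fe j * fk i.hi) (fk i.hi * fe i * fe j)
  | ffk (i j : Adj n) (h : j.1 = i.1 + 1) :
      URel (ff j * ff i * fk i.hi) (fk i.hi * ff j * ff i)

variable (n) in
/-- The degenerate quantum group `U_0(gl_n)`. -/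
def U0 : Type := RingQuot (URel (n := n))

instance : Ring (U0 n) := inferInstanceAs (Ring (RingQuot (URel (n := n))))

instance : Algebra ℂ (U0 n) := inferInstanceAs (Algebra ℂ (RingQuot (URel (n := n))))

/-- The quotient map from the free algebra. -/
def U0.mk : FreeAlgebra ℂ (UGen n) →ₐ[ℂ] U0 n := RingQuot.mkAlgHom ℂ (URel (n := n))

/-- The generators `e_i` of `U_0(gl_n)`. -/
def U0.e (i : Adj n) : U0 n := U0.mk (fe i)

/-- The generators `f_i` of `U_0(gl_n)`. -/
def U0.f (i : Adj n) : U0 n := U0.mk (ff i)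

/-- The generators `k_i` of `U_0(gl_n)`. -/
def U0.k (i : Fin n) : U0 n := U0.mk (fk i)

theorem U0.rel {x y : FreeAlgebra ℂ (UGen n)} (h : URel x y) : U0.mk x = U0.mk y :=
  RingQuot.mkAlgHom_rel ℂ h

/-- The values of the comultiplication on the generators. -/
def comulGen : UGen n → U0 n ⊗[ℂ] U0 n
  | .e i => 1 ⊗ₜ U0.e i + U0.e i ⊗ₜ U0.k i.lo
  | .f i => U0.k i.hi ⊗ₜ U0.f i + U0.f i ⊗ₜ 1
  | .k i => U0.k i ⊗ₜ U0.k i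

theorem lift_comulGen_rel (x y : FreeAlgebra ℂ (UGen n)) (h : URel x y) :
    FreeAlgebra.lift ℂ comulGen x = FreeAlgebra.lift ℂ comulGen y := by
  have kk : ∀ i j : Fin n, U0.k i * U0.k j = U0.k j * U0.k i := fun i j => by
    simpa [U0.k] using U0.rel (URel.kk i j)
  have ek0 : ∀ i : Adj n, U0.e i * U0.k i.hi = 0 := fun i => by
    simpa [U0.k, U0.e] using U0.rel (URel.ek_zero i)
  have ke0 : ∀ i : Adj n, U0.k i.lo * U0.e i = 0 := fun i => by
    simpa [U0.k, U0.e] using U0.rel (URel.ke_zero i)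
  have kf0 : ∀ i : Adj n, U0.k i.hi * U0.f i = 0 := fun i => by
    simpa [U0.k, U0.f] using U0.rel (URel.kf_zero i)
  have fk0 : ∀ i : Adj n, U0.f i * U0.k i.lo = 0 := fun i => by
    simpa [U0.k, U0.f] using U0.rel (URel.fk_zero i)
  have ke : ∀ (i : Fin n) (j : Adj n), i ≠ j.lo → i ≠ j.hi →
      U0.k i * U0.e j = U0.e j * U0.k i := fun i j h h' => by
    simpa [U0.k, U0.e] using U0.rel (URel.ke i j h h')
  have kf : ∀ (i : Fin n) (j : Adj n), i ≠ j.lo → i ≠ j.hi →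
      U0.k i * U0.f j = U0.f j * U0.k i := fun i j h h' => by
    simpa [U0.k, U0.f] using U0.rel (URel.kf i j h h')
  have efs : ∀ i : Adj n, U0.e i * U0.f i = U0.f i * U0.e i + (U0.k i.hi - U0.k i.lo) :=
    fun i => by
      have := U0.rel (URel.ef_same i)
      simp only [map_sub, map_mul] at this
      rw [← sub_eq_iff_eq_add']
      exact this
  have efn : ∀ i j : Adj n, i ≠ j → U0.e i * U0.f j = U0.f j * U0.e i := fun i j h => by
    simpa [U0.e, U0.f] using U0.rel (URel.ef_ne i j h)
  have lohi : ∀ i j : Adj n, j.1 = i.1 + 1 → j.lo = i.hi := fun i j h => by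
    simp [Adj.lo, Adj.hi, h]
  have ass : ∀ {a b c : U0 n}, a * b = c → ∀ x, a * (b * x) = c * x := fun h x => by
    rw [← mul_assoc, h]
  have kg : ∀ i j : Adj n, j.1 = i.1 + 1 → U0.k i.lo * U0.e j = U0.e j * U0.k i.lo :=
    fun i j h => ke _ _ (by simp only [Adj.lo, ne_eq, Fin.mk.injEq]; omega)
      (by simp only [Adj.lo, Adj.hi, ne_eq, Fin.mk.injEq]; omega)
  have kb : ∀ i j : Adj n, j.1 = i.1 + 1 → U0.k j.hi * U0.f i = U0.f i * U0.k j.hi :=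
    fun i j h => kf _ _ (by simp only [Adj.lo, Adj.hi, ne_eq, Fin.mk.injEq]; omega)
      (by simp only [Adj.hi, ne_eq, Fin.mk.injEq]; omega)
  induction h with
  | kk i j => simp [fk, comulGen, kk i j]
  | ek_zero i => simp [fe, fk, comulGen, add_mul, ek0]
  | ke_zero i => simp [fe, fk, comulGen, mul_add, ke0]
  | ke i j h h' => simp [fe, fk, comulGen, mul_add, add_mul, ke i j h h', kk i]
  | kf_zero i => simp [ff, fk, comulGen, mul_add, kf0]
  | fk_zero i => simp [ff, fk, comulGen, add_mul, fk0]
  | kf i j h h' => simp [ff, fk, comulGen, mul_add, add_mul, kf i j h h', kk i]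
  | ef_same i =>
    simp only [fe, ff, fk, comulGen, map_mul, map_sub, FreeAlgebra.lift_ι_apply, mul_add, add_mul,
      Algebra.TensorProduct.tmul_mul_tmul, efs, ek0, fk0, one_mul, mul_one, TensorProduct.tmul_add,
      TensorProduct.add_tmul, TensorProduct.tmul_sub, TensorProduct.sub_tmul,
      TensorProduct.tmul_zero, TensorProduct.zero_tmul]
    abel
  | ef_ne i j h =>
    have hx : (U0.e i * U0.k j.hi) ⊗ₜ[ℂ] (U0.k i.lo * U0.f j) =
        (U0.k j.hi * U0.e i) ⊗ₜ[ℂ] (U0.f j * U0.k i.lo) := by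
      have hij : i.1 ≠ j.1 := fun hh => h (Subtype.ext hh)
      by_cases h1 : i.1 = j.1 + 1
      · have h2 : i.lo = j.hi := lohi j i h1
        rw [← h2, ke0]
        rw [h2, kf0]
        simp
      · rw [ke j.hi i (by simp only [Adj.lo, Adj.hi, ne_eq, Fin.mk.injEq]; omega)
          (by simp only [Adj.hi, ne_eq, Fin.mk.injEq]; omega),
          kf i.lo j (by simp only [Adj.lo, ne_eq, Fin.mk.injEq]; omega)
          (by simp only [Adj.lo, Adj.hi, ne_eq, Fin.mk.injEq]; omega)]
    simp only [fe, ff, comulGen, map_mul, FreeAlgebra.lift_ι_apply, mul_add, add_mul,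
      Algebra.TensorProduct.tmul_mul_tmul, efn i j h, one_mul, mul_one, hx]
    abel
  | ee1 i j h =>
    have a1 := ass (ke0 i)
    have a2 := ass (ek0 i)
    have a3 := ass (kg i j h)
    have a4 := ass (kk i.lo i.hi)
    have a5 : U0.e i * (U0.e i * U0.e j) = U0.e i * (U0.e j * U0.e i) := by
      simpa [U0.e, mul_assoc] using U0.rel (URel.ee1 i j h)
    simp only [fe, comulGen, map_mul, FreeAlgebra.lift_ι_apply, mul_add, add_mul, lohi i j h,
      Algebra.TensorProduct.tmul_mul_tmul, one_mul, mul_one, mul_assoc, ke0 i, ek0 i, kg i j h,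
      kk i.lo i.hi, a1, a2, a3, a4, a5, zero_mul, mul_zero, TensorProduct.tmul_zero,
      TensorProduct.zero_tmul]
    abel
  | ee2 i j h =>
    have a0 : U0.k i.hi * U0.e j = 0 := lohi i j h ▸ ke0 j
    have a1 := ass a0
    have a2 := ass (ek0 i)
    have a3 := ass (kg i j h)
    have a4 := ass (kk i.hi i.lo)
    have a5 : U0.e i * (U0.e j * U0.e j) = U0.e j * (U0.e i * U0.e j) := by
      simpa [U0.e, mul_assoc] using U0.rel (URel.ee2 i j h)
    have a6 : U0.e i * (U0.e j * U0.k i.hi) = U0.k i.hi * (U0.e i * U0.e j) := by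
      simpa [U0.e, U0.k, mul_assoc] using U0.rel (URel.eek i j h)
    simp only [fe, comulGen, map_mul, FreeAlgebra.lift_ι_apply, mul_add, add_mul, lohi i j h,
      Algebra.TensorProduct.tmul_mul_tmul, one_mul, mul_one, mul_assoc, a0, ek0 i, kg i j h,
      kk i.hi i.lo, a1, a2, a3, a4, a5, a6, zero_mul, mul_zero, TensorProduct.tmul_zero,
      TensorProduct.zero_tmul]
    abel
  | ff1 i j h =>
    have a0 : U0.k j.hi * U0.k i.hi = U0.k i.hi * U0.k j.hi := kk _ _
    have a1 := ass a0
    have a2 := ass (kf0 i)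
    have a3 := ass (kb i j h)
    have a5 : U0.f j * (U0.f i * U0.f i) = U0.f i * (U0.f j * U0.f i) := by
      simpa [U0.f, mul_assoc] using U0.rel (URel.ff1 i j h)
    have a6 : U0.f j * (U0.f i * U0.k i.hi) = U0.k i.hi * (U0.f j * U0.f i) := by
      simpa [U0.f, U0.k, mul_assoc] using U0.rel (URel.ffk i j h)
    have a7 : U0.f j * U0.k i.hi = 0 := lohi i j h ▸ fk0 j
    have a8 := ass a7
    simp only [ff, comulGen, map_mul, FreeAlgebra.lift_ι_apply, mul_add, add_mul,
      Algebra.TensorProduct.tmul_mul_tmul, one_mul, mul_one, mul_assoc, a0, kf0 i, kb i j h,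
      a1, a2, a3, a5, a6, a7, a8, zero_mul, mul_zero, TensorProduct.tmul_zero,
      TensorProduct.zero_tmul]
    abel
  | ff2 i j h =>
    have a0 : U0.k j.hi * U0.k i.hi = U0.k i.hi * U0.k j.hi := kk _ _
    have a1 := ass a0
    have a2 := ass (kf0 j)
    have a3 := ass (kb i j h)
    have a5 : U0.f j * (U0.f j * U0.f i) = U0.f j * (U0.f i * U0.f j) := by
      simpa [U0.f, mul_assoc] using U0.rel (URel.ff2 i j h)
    have a7 : U0.f j * U0.k i.hi = 0 := lohi i j h ▸ fk0 j
    have a8 := ass a7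
    simp only [ff, comulGen, map_mul, FreeAlgebra.lift_ι_apply, mul_add, add_mul,
      Algebra.TensorProduct.tmul_mul_tmul, one_mul, mul_one, mul_assoc, a0, kf0 j, kb i j h,
      a1, a2, a3, a5, a7, a8, zero_mul, mul_zero, TensorProduct.tmul_zero,
      TensorProduct.zero_tmul]
    abel
  | ee_far i j h =>
    have a1 : U0.e i * U0.e j = U0.e j * U0.e i := by
      simpa [U0.e] using U0.rel (URel.ee_far i j h)
    have a2 : U0.k i.lo * U0.e j = U0.e j * U0.k i.lo :=
      ke _ _ (by simp only [Adj.lo, ne_eq, Fin.mk.injEq]; omega)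
        (by simp only [Adj.lo, Adj.hi, ne_eq, Fin.mk.injEq]; omega)
    have a3 : U0.k j.lo * U0.e i = U0.e i * U0.k j.lo :=
      ke _ _ (by simp only [Adj.lo, ne_eq, Fin.mk.injEq]; omega)
        (by simp only [Adj.lo, Adj.hi, ne_eq, Fin.mk.injEq]; omega)
    simp only [fe, comulGen, map_mul, FreeAlgebra.lift_ι_apply, mul_add, add_mul,
      Algebra.TensorProduct.tmul_mul_tmul, one_mul, mul_one, a1, a2, a3, kk j.lo i.lo]
    abel
  | ff_far i j h =>
    have a1 : U0.f i * U0.f j = U0.f j * U0.f i := by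
      simpa [U0.f] using U0.rel (URel.ff_far i j h)
    have a2 : U0.k i.hi * U0.f j = U0.f j * U0.k i.hi :=
      kf _ _ (by simp only [Adj.lo, Adj.hi, ne_eq, Fin.mk.injEq]; omega)
        (by simp only [Adj.hi, ne_eq, Fin.mk.injEq]; omega)
    have a3 : U0.k j.hi * U0.f i = U0.f i * U0.k j.hi :=
      kf _ _ (by simp only [Adj.lo, Adj.hi, ne_eq, Fin.mk.injEq]; omega)
        (by simp only [Adj.hi, ne_eq, Fin.mk.injEq]; omega)
    simp only [ff, comulGen, map_mul, FreeAlgebra.lift_ι_apply, mul_add, add_mul,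
      Algebra.TensorProduct.tmul_mul_tmul, one_mul, mul_one, a1, a2, a3, kk j.hi i.hi]
    abel
  | eek i j h =>
    have a0 : U0.k i.hi * U0.e j = 0 := lohi i j h ▸ ke0 j
    have a1 := ass a0
    have a2 := ass (ek0 i)
    have a3 := ass (kg i j h)
    have a4 := ass (kk i.hi i.lo)
    have a6 : U0.e i * (U0.e j * U0.k i.hi) = U0.k i.hi * (U0.e i * U0.e j) := by
      simpa [U0.e, U0.k, mul_assoc] using U0.rel (URel.eek i j h)
    simp only [fe, fk, comulGen, map_mul, FreeAlgebra.lift_ι_apply, mul_add, add_mul, lohi i j h,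
      Algebra.TensorProduct.tmul_mul_tmul, one_mul, mul_one, mul_assoc, a0, ek0 i, kg i j h,
      kk i.hi i.lo, a1, a2, a3, a4, a6, zero_mul, mul_zero, TensorProduct.tmul_zero,
      TensorProduct.zero_tmul]
  | ffk i j h =>
    have a0 : U0.k j.hi * U0.k i.hi = U0.k i.hi * U0.k j.hi := kk _ _
    have a1 := ass a0
    have a2 := ass (kf0 i)
    have a3 := ass (kb i j h)
    have a6 : U0.f j * (U0.f i * U0.k i.hi) = U0.k i.hi * (U0.f j * U0.f i) := by
      simpa [U0.f, U0.k, mul_assoc] using U0.rel (URel.ffk i j h)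
    have a7 : U0.f j * U0.k i.hi = 0 := lohi i j h ▸ fk0 j
    have a8 := ass a7
    simp only [ff, fk, comulGen, map_mul, FreeAlgebra.lift_ι_apply, mul_add, add_mul,
      Algebra.TensorProduct.tmul_mul_tmul, one_mul, mul_one, mul_assoc, a0, kf0 i, kb i j h,
      a1, a2, a3, a6, a7, a8, zero_mul, mul_zero, TensorProduct.tmul_zero,
      TensorProduct.zero_tmul]

/-- The comultiplication `Δ`. -/
def comul : U0 n →ₐ[ℂ] U0 n ⊗[ℂ] U0 n :=
  RingQuot.liftAlgHom ℂ ⟨FreeAlgebra.lift ℂ comulGen, lift_comulGen_rel⟩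

/-- The values of the counit on the generators. -/
def counitGen : UGen n → ℂ
  | .e _ => 0
  | .f _ => 0
  | .k _ => 1

/-- The counit `ε`. -/
def counit : U0 n →ₐ[ℂ] ℂ :=
  RingQuot.liftAlgHom ℂ ⟨FreeAlgebra.lift ℂ counitGen, by
    intro x y h
    induction h <;> simp [fe, ff, fk, counitGen]⟩

/-- The values of the natural representation on the generators, as matrices. -/
def rhoGen : UGen n → Matrix (Fin n) (Fin n) ℂ
  | .e i => Matrix.single i.lo i.hi 1
  | .f i => Matrix.single i.hi i.lo 1
  | .k i => ∑ j ∈ Finset.univ.erase i, Matrix.single j j 1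

theorem lift_rhoGen_rel (x y : FreeAlgebra ℂ (UGen n)) (h : URel x y) :
    FreeAlgebra.lift ℂ rhoGen x = FreeAlgebra.lift ℂ rhoGen y := by
  have hk : ∀ i : Fin n, ∑ j ∈ Finset.univ.erase i, Matrix.single j j (1 : ℂ) =
      1 - Matrix.single i i 1 := by
    intro i
    rw [eq_sub_iff_add_eq, Finset.sum_erase_add _ _ (Finset.mem_univ i)]
    ext a b
    simp [Matrix.sum_apply, Matrix.single_apply, Matrix.one_apply, ite_and]
  have hne : ∀ i : Adj n, i.lo ≠ i.hi := fun i => by simp [Adj.lo, Adj.hi]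
  have e0 : ∀ i j k l : Fin n, j ≠ k →
      (Matrix.single i j 1 * Matrix.single k l 1 : Matrix (Fin n) (Fin n) ℂ) = 0 :=
    fun i j k l h => Matrix.single_mul_single_of_ne _ _ _ _ h _
  have e1 : ∀ i j k : Fin n,
      (Matrix.single i j 1 * Matrix.single j k 1 : Matrix (Fin n) (Fin n) ℂ) =
        Matrix.single i k 1 := fun i j k => by simp
  have lohi : ∀ i j : Adj n, j.1 = i.1 + 1 → j.lo = i.hi ∧ i.lo ≠ j.hi ∧ i.hi ≠ j.hi :=
    fun i j h => by
      simp only [Adj.lo, Adj.hi, ne_eq, Fin.mk.injEq]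
      omega
  have far : ∀ i j : Adj n, i.1 + 1 < j.1 ∨ j.1 + 1 < i.1 → i.lo ≠ j.hi ∧ i.hi ≠ j.lo :=
    fun i j h => by
      simp only [Adj.lo, Adj.hi, ne_eq, Fin.mk.injEq]
      omega
  have ne : ∀ i j : Adj n, i ≠ j → i.lo ≠ j.lo ∧ i.hi ≠ j.hi := fun i j h => by
    have : i.1 ≠ j.1 := fun hh => h (Subtype.ext hh)
    simp only [Adj.lo, Adj.hi, ne_eq, Fin.mk.injEq]
    omega
  induction h with
  | kk i j =>
    rcases eq_or_ne i j with rfl | h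
    · rfl
    · simp [fk, rhoGen, hk, mul_sub, sub_mul, e0 _ _ _ _ h, e0 _ _ _ _ h.symm]
      abel
  | ek_zero i => simp [fe, fk, rhoGen, hk, mul_sub]
  | ke_zero i => simp [fe, fk, rhoGen, hk, sub_mul]
  | ke i j h h' =>
    simp [fe, fk, rhoGen, hk, mul_sub, sub_mul, e0 _ _ _ _ h, e0 _ _ _ _ h'.symm]
  | kf_zero i => simp [ff, fk, rhoGen, hk, sub_mul]
  | fk_zero i => simp [ff, fk, rhoGen, hk, mul_sub]
  | kf i j h h' =>
    simp [ff, fk, rhoGen, hk, mul_sub, sub_mul, e0 _ _ _ _ h', e0 _ _ _ _ h.symm]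
  | ef_same i => simp [fe, ff, fk, rhoGen, hk]
  | ef_ne i j h =>
    simp [fe, ff, rhoGen, e0 _ _ _ _ (ne i j h).2, e0 _ _ _ _ (ne i j h).1.symm]
  | ee1 i j h =>
    obtain ⟨h1, h2, h3⟩ := lohi i j h
    simp [fe, rhoGen, h1, e0 _ _ _ _ h2.symm, e0 _ _ _ _ (hne i).symm]
  | ee2 i j h =>
    obtain ⟨h1, h2, h3⟩ := lohi i j h
    simp [fe, rhoGen, h1, e0 _ _ _ _ h2.symm, e0 _ _ _ _ h3.symm]
  | ff1 i j h =>
    obtain ⟨h1, h2, h3⟩ := lohi i j h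
    simp [ff, rhoGen, h1, mul_assoc, e0 _ _ _ _ h2, e0 _ _ _ _ (hne i)]
  | ff2 i j h =>
    obtain ⟨h1, h2, h3⟩ := lohi i j h
    simp [ff, rhoGen, h1, mul_assoc, e0 _ _ _ _ h2, e0 _ _ _ _ h3]
  | ee_far i j h =>
    obtain ⟨h1, h2⟩ := far i j h
    simp [fe, rhoGen, e0 _ _ _ _ h2, e0 _ _ _ _ h1.symm]
  | ff_far i j h =>
    obtain ⟨h1, h2⟩ := far i j h
    simp [ff, rhoGen, e0 _ _ _ _ h1, e0 _ _ _ _ h2.symm]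
  | eek i j h =>
    obtain ⟨h1, h2, h3⟩ := lohi i j h
    simp [fe, fk, rhoGen, hk, h1, mul_sub, sub_mul, e0 _ _ _ _ h3.symm, e0 _ _ _ _ (hne i).symm]
  | ffk i j h =>
    obtain ⟨h1, h2, h3⟩ := lohi i j h
    simp [ff, fk, rhoGen, hk, h1, mul_sub, sub_mul, e0 _ _ _ _ h3, e0 _ _ _ _ (hne i)]

/-- The natural representation of `U_0(gl_n)` on `ℂ^n`. -/
def rhoV : U0 n →ₐ[ℂ] Module.End ℂ (Fin n → ℂ) :=
  (Matrix.toLinAlgEquiv' : Matrix (Fin n) (Fin n) ℂ ≃ₐ[ℂ] _).toAlgHom.comp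
    (RingQuot.liftAlgHom ℂ ⟨FreeAlgebra.lift ℂ rhoGen, lift_rhoGen_rel⟩)

/-- The isomorphism `V^{⊗ r} ⊗ V ≅ V^{⊗ (r + 1)}`. -/
def snocEquiv (n r : ℕ) : TSpace ℂ n r ⊗[ℂ] (Fin n → ℂ) ≃ₗ[ℂ] TSpace ℂ n (r + 1) :=
  (TensorProduct.congr (LinearEquiv.refl ℂ _)
    (PiTensorProduct.subsingletonEquiv (R := ℂ) (s := fun _ : Fin 1 => (Fin n → ℂ)) 0).symm).trans
    TensorPower.mulEquiv

/-- The representation of `U_0(gl_n)` on `V^{⊗ r}` given by the counit for `r = 0` and by the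
comultiplication for larger `r`. -/
def rhoT (n : ℕ) : (r : ℕ) → U0 n →ₐ[ℂ] Module.End ℂ (TSpace ℂ n r)
  | 0 => (Algebra.ofId ℂ (Module.End ℂ (TSpace ℂ n 0))).comp counit
  | r + 1 => (snocEquiv n r).conjAlgEquiv ℂ |>.toAlgHom.comp
      ((Module.endTensorEndAlgHom (R := ℂ) (S := ℂ) (A := ℂ)).comp
        ((Algebra.TensorProduct.map (rhoT n r) rhoV).comp comul))

end U

end ZeroSchur

end

/-!
Encode a basis tensor `ξ_k` by the word `k`. The word that is obtained from the weakly increasing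
word of weight `l` by a permutation `w` of the positions corresponds to the element `x_l T_w`, so
`x_l H` is spanned by the words of weight `l`, and the right module `⨁ x_l H` is the tensor space.
An endomorphism is determined by the images of the increasing words. Such an image `v` satisfies
`v T_i = q v` whenever `s_i` fixes the increasing word, which means that the coefficient of `v` at
a word `k` depends only on the matrix that counts the pairs of letters of `k` and of the increasing
word. Hence the `e_A` form a basis over every coefficient ring, the Schur algebra specializes well
at `q = 0`, and `e_A` sends the increasing word of weight `co A` to the sum of all words with
matrix `A`.

Iterating the comultiplication, `e_i` acts on a word by the sum over the letters `i + 1` with no `i`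
to their right, each of them replaced by `i`. In an increasing word no such obstruction occurs, and
the words that arise are those with matrix `D_l - E_{i+1,i+1} + E_{i,i+1}`. Symmetrically, `f_i`
replaces the letters `i` with no `i + 1` to their left, while `k_i` kills the words that contain `i`
and fixes the others. The two actions commute by induction on `r`: splitting off the last tensor
factor, only the Hecke generator of the last two factors needs a computation.
-/

open scoped TensorProduct DirectSum

noncomputable section

namespace ZeroSchur

/-! ### Words and their inversions -/

section Words

variable {r : ℕ} {α β : Type*}

theorem Adj.lo_lt_hi (i : Adj r) : i.lo < i.hi := Nat.lt_succ_self _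

theorem simpleSwap_lo (i : Adj r) : simpleSwap i i.lo = i.hi := Equiv.swap_apply_left _ _

theorem simpleSwap_hi (i : Adj r) : simpleSwap i i.hi = i.lo := Equiv.swap_apply_right _ _

theorem simpleSwap_of_ne {i : Adj r} {p : Fin r} (h : p ≠ i.lo) (h' : p ≠ i.hi) :
    simpleSwap i p = p := Equiv.swap_apply_of_ne_of_ne h h'

theorem simpleSwap_simpleSwap (i : Adj r) (p : Fin r) : simpleSwap i (simpleSwap i p) = p :=
  Equiv.swap_apply_self _ _ _

theorem simpleSwap_mul_self (i : Adj r) : simpleSwap i * simpleSwap i = 1 :=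
  Equiv.swap_mul_self _ _

theorem coe_mul_simpleSwap (w : Equiv.Perm (Fin r)) (i : Adj r) :
    ⇑(w * simpleSwap i) = w ∘ simpleSwap i := rfl

theorem comp_simpleSwap_comp_simpleSwap (k : Fin r → β) (i : Adj r) :
    (k ∘ simpleSwap i) ∘ simpleSwap i = k :=
  funext fun p => congrArg k (simpleSwap_simpleSwap i p)

theorem comp_simpleSwap_eq_iff {k k' : Fin r → β} {i : Adj r} :
    k ∘ simpleSwap i = k' ↔ k = k' ∘ simpleSwap i :=
  ⟨fun h => by rw [← h, comp_simpleSwap_comp_simpleSwap],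
    fun h => by rw [h, comp_simpleSwap_comp_simpleSwap]⟩

theorem comp_simpleSwap_eq_self {k : Fin r → β} {i : Adj r} (h : k i.lo = k i.hi) :
    k ∘ simpleSwap i = k := by
  funext p
  rcases eq_or_ne p i.lo with rfl | hlo
  · simp [simpleSwap_lo, h]
  rcases eq_or_ne p i.hi with rfl | hhi
  · simp [simpleSwap_hi, h]
  · simp [simpleSwap_of_ne hlo hhi]

theorem simpleSwap_lt_simpleSwap {i : Adj r} {a b : Fin r} (hab : a < b)
    (h : ¬(a = i.lo ∧ b = i.hi)) : simpleSwap i a < simpleSwap i b := by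
  simp only [simpleSwap, Equiv.swap_apply_def]
  simp only [Adj.lo, Adj.hi, Fin.lt_def, Fin.ext_iff] at *
  split_ifs <;> simp_all <;> omega

variable [LinearOrder α]

/-- The pairs of positions at which a word is out of order. -/
def inversions (k : Fin r → α) : Finset (Fin r × Fin r) :=
  Finset.univ.filter fun p => p.1 < p.2 ∧ k p.2 < k p.1

/-- The number of inversions of a word; for a permutation this is its Coxeter length. -/
def inversionCount (k : Fin r → α) : ℕ := (inversions k).card

theorem mem_inversions {k : Fin r → α} {p : Fin r × Fin r} :
    p ∈ inversions k ↔ p.1 < p.2 ∧ k p.2 < k p.1 := by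
  simp [inversions]

theorem inversionCount_eq_zero {k : Fin r → α} (h : Monotone k) : inversionCount k = 0 := by
  rw [inversionCount, Finset.card_eq_zero, Finset.eq_empty_iff_forall_notMem]
  intro p hp
  obtain ⟨hlt, hk⟩ := mem_inversions.1 hp
  exact hk.not_ge (h hlt.le)

theorem inversions_comp_simpleSwap {k : Fin r → α} {i : Adj r} (h : k i.lo < k i.hi) :
    inversions (k ∘ simpleSwap i) = insert (i.lo, i.hi)
      ((inversions k).map ((simpleSwap i).prodCongr (simpleSwap i)).toEmbedding) := by
  ext ⟨a, b⟩
  have hsymm : ((simpleSwap i).prodCongr (simpleSwap i)).symm (a, b) =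
      (simpleSwap i a, simpleSwap i b) := by
    simp [simpleSwap]
  simp only [mem_inversions, Finset.mem_insert, Finset.mem_map_equiv, hsymm, Function.comp,
    Prod.mk.injEq]
  by_cases hab : a = i.lo ∧ b = i.hi
  · obtain ⟨rfl, rfl⟩ := hab
    simp [simpleSwap_lo, simpleSwap_hi, h, i.lo_lt_hi]
  simp only [hab, false_or]
  refine and_congr_left fun hk => ⟨fun hlt => simpleSwap_lt_simpleSwap hlt hab, fun hlt => ?_⟩
  rw [← simpleSwap_simpleSwap i a, ← simpleSwap_simpleSwap i b]
  refine simpleSwap_lt_simpleSwap hlt ?_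
  rintro ⟨ha, hb⟩
  rw [ha, hb] at hk
  exact lt_asymm h hk

theorem inversionCount_comp_simpleSwap_of_lt {k : Fin r → α} {i : Adj r} (h : k i.lo < k i.hi) :
    inversionCount (k ∘ simpleSwap i) = inversionCount k + 1 := by
  rw [inversionCount, inversions_comp_simpleSwap h, Finset.card_insert_of_notMem,
    Finset.card_map, inversionCount]
  rw [Finset.mem_map_equiv]
  simp [mem_inversions, simpleSwap, i.lo_lt_hi.le]

theorem inversionCount_comp_simpleSwap_of_gt {k : Fin r → α} {i : Adj r} (h : k i.hi < k i.lo) :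
    inversionCount (k ∘ simpleSwap i) + 1 = inversionCount k := by
  rw [← inversionCount_comp_simpleSwap_of_lt (k := k ∘ simpleSwap i) (i := i),
    comp_simpleSwap_comp_simpleSwap]
  simpa only [Function.comp, simpleSwap_lo, simpleSwap_hi] using h

theorem inversionCount_comp_simpleSwap_le (k : Fin r → α) (i : Adj r) :
    inversionCount (k ∘ simpleSwap i) ≤ inversionCount k + 1 := by
  rcases lt_trichotomy (k i.lo) (k i.hi) with h | h | h
  · exact (inversionCount_comp_simpleSwap_of_lt h).le
  · rw [comp_simpleSwap_eq_self h]
    exact Nat.le_succ _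
  · have := inversionCount_comp_simpleSwap_of_gt h
    omega

theorem exists_descent {k : Fin r → α} (h : ¬Monotone k) : ∃ i : Adj r, k i.hi < k i.lo := by
  rcases r with _ | r
  · exact absurd (fun a => a.elim0) h
  · rw [Fin.monotone_iff_le_succ] at h
    push Not at h
    obtain ⟨i, hi⟩ := h
    exact ⟨⟨i.1, by omega⟩, hi⟩

theorem word_induction {P : (Fin r → α) → Prop} (mono : ∀ k, Monotone k → P k)
    (step : ∀ (k : Fin r → α) (i : Adj r), k i.lo < k i.hi → P k → P (k ∘ simpleSwap i))
    (k : Fin r → α) : P k := by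
  induction hm : inversionCount k using Nat.strong_induction_on generalizing k with
  | _ m ih =>
    by_cases hk : Monotone k
    · exact mono k hk
    · obtain ⟨i, hi⟩ := exists_descent hk
      have := inversionCount_comp_simpleSwap_of_gt hi
      rw [← comp_simpleSwap_comp_simpleSwap k i]
      refine step _ i ?_ (ih _ (by omega) _ rfl)
      simpa only [Function.comp, simpleSwap_lo, simpleSwap_hi] using hi

theorem perm_eq_one_of_monotone {w : Equiv.Perm (Fin r)} (h : Monotone w) : w = 1 :=
  DFunLike.coe_injective (Tuple.unique_monotone (f := id) (τ := 1) h monotone_id)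

theorem perm_induction {P : Equiv.Perm (Fin r) → Prop} (one : P 1)
    (mul_simpleSwap : ∀ (w : Equiv.Perm (Fin r)) (i : Adj r), w i.lo < w i.hi → P w →
      P (w * simpleSwap i)) (w : Equiv.Perm (Fin r)) : P w := by
  suffices h : ∀ k : Fin r → Fin r, ∀ w : Equiv.Perm (Fin r), ⇑w = k → P w from h w w rfl
  intro k
  induction k using word_induction with
  | mono k hk =>
    rintro w rfl
    rwa [perm_eq_one_of_monotone hk]
  | step k i hi ih =>
    intro w hw
    have hk : ⇑(w * simpleSwap i) = k := by
      rw [coe_mul_simpleSwap, hw, comp_simpleSwap_comp_simpleSwap]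
    have := mul_simpleSwap (w * simpleSwap i) i (by rwa [hk]) (ih _ hk)
    rwa [mul_assoc, simpleSwap_mul_self, mul_one] at this

end Words

/-! ### Letter counts -/

section LetterCount

variable {ι κ β γ : Type*} [Fintype ι] [Fintype κ] [DecidableEq β] [DecidableEq γ]

/-- The number of occurrences of each letter in a word, whose positions form the type `ι`. -/
def letterCount (k : ι → β) (b : β) : ℕ := (Finset.univ.filter fun p => k p = b).card

theorem letterCount_pos {k : ι → β} {b : β} : 0 < letterCount k b ↔ ∃ p, k p = b := by
  simp [letterCount, Finset.card_pos, Finset.Nonempty]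

theorem letterCount_comp_equiv (k : ι → β) (e : κ ≃ ι) :
    letterCount (k ∘ e) = letterCount k :=
  funext fun b => Finset.card_equiv e fun p => by simp

theorem letterCount_sigma_fst [Fintype β] (l : β → ℕ) :
    letterCount (Sigma.fst : (Σ b, Fin (l b)) → β) = l := by
  funext b
  rw [letterCount, ← Fintype.card_subtype, Fintype.card_congr (Equiv.sigmaSubtype b),
    Fintype.card_fin]

theorem exists_comp_perm_eq {k m : ι → β} (h : letterCount k = letterCount m) :
    ∃ w : Equiv.Perm ι, k ∘ w = m := by
  have hfib : ∀ b, Nonempty ({p // m p = b} ≃ {p // k p = b}) := fun b => by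
    rw [← Fintype.card_eq, Fintype.card_subtype, Fintype.card_subtype]
    exact (congrFun h b).symm
  exact ⟨Equiv.ofFiberEquiv fun b => (hfib b).some, funext (Equiv.ofFiberEquiv_map _)⟩

theorem exists_letterCount_eq [Fintype β] {r : ℕ} {l : β → ℕ} (hl : ∑ b, l b = r) :
    ∃ k : Fin r → β, letterCount k = l := by
  have hcard : Fintype.card (Σ b, Fin (l b)) = r := by
    simp only [Fintype.card_sigma, Fintype.card_fin, hl]
  exact ⟨Sigma.fst ∘ (Fintype.equivFinOfCardEq hcard).symm,
    by rw [letterCount_comp_equiv, letterCount_sigma_fst]⟩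

theorem sum_letterCount [Fintype β] (k : ι → β) : ∑ b, letterCount k b = Fintype.card ι :=
  (Finset.card_eq_sum_card_fiberwise fun _ _ => Finset.mem_coe.2 (Finset.mem_univ _)).symm

theorem sum_letterCount_prod_right [Fintype γ] (k : ι → β) (m : ι → γ) (b : β) :
    ∑ c, letterCount (fun p => (k p, m p)) (b, c) = letterCount k b := by
  rw [letterCount, Finset.card_eq_sum_card_fiberwise (f := m) (t := Finset.univ)
    fun _ _ => Finset.mem_coe.2 (Finset.mem_univ _)]
  simp only [letterCount, Finset.filter_filter, Prod.mk.injEq]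

theorem letterCount_swap (k : ι → β) (m : ι → γ) (b : β) (c : γ) :
    letterCount (fun p => (k p, m p)) (b, c) = letterCount (fun p => (m p, k p)) (c, b) := by
  simp only [letterCount, Prod.mk.injEq, and_comm]

theorem eq_of_monotone_of_letterCount_eq {α : Type*} [LinearOrder α] {r : ℕ} {k m : Fin r → α}
    (hk : Monotone k) (hm : Monotone m) (h : letterCount k = letterCount m) : k = m := by
  obtain ⟨w, rfl⟩ := exists_comp_perm_eq h
  exact Tuple.unique_monotone (σ := 1) hk hm

end LetterCount

/-! ### Weights of words and matrices of pairs of words -/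

section Weights

variable {n r : ℕ}

theorem finSigmaFinEquiv_lt {m : ℕ} {l : Fin m → ℕ} {x y : (i : Fin m) × Fin (l i)}
    (h : x.1 < y.1) : finSigmaFinEquiv x < finSigmaFinEquiv y := by
  have hIio : ∀ i : Fin m, ∑ a : Fin i, l (Fin.castLE i.2.le a) = ∑ a ∈ Finset.Iio i, l a := by
    intro i
    refine (Finset.sum_map Finset.univ (Fin.castLEEmb i.2.le) l).symm.trans
      (Finset.sum_congr (Finset.ext fun a => ?_) fun _ _ => rfl)
    simp only [Finset.mem_map, Finset.mem_univ, true_and, Finset.mem_Iio]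
    exact ⟨fun ⟨b, hb⟩ => hb ▸ b.2, fun ha => ⟨⟨a, ha⟩, rfl⟩⟩
  rw [Fin.lt_def, finSigmaFinEquiv_apply, finSigmaFinEquiv_apply, hIio, hIio]
  calc ∑ a ∈ Finset.Iio x.1, l a + x.2 < ∑ a ∈ Finset.Iio x.1, l a + l x.1 := by omega
    _ = ∑ a ∈ Finset.Iic x.1, l a := by
      rw [← Finset.Iio_insert, Finset.sum_insert (by simp), add_comm]
    _ ≤ ∑ a ∈ Finset.Iio y.1, l a :=
      Finset.sum_le_sum_of_subset fun a ha =>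
        Finset.mem_Iio.2 ((Finset.mem_Iic.1 ha).trans_lt h)
    _ ≤ ∑ a ∈ Finset.Iio y.1, l a + y.2 := Nat.le_add_right _ _

theorem iword_monotone (l : WComp n r) : Monotone (iword l) := by
  intro p p' hp
  by_contra! hlt
  have := finSigmaFinEquiv_lt hlt
  rw [Equiv.apply_symm_apply, Equiv.apply_symm_apply] at this
  exact this.not_ge hp

/-- The weight of a word of length `r` in the letters `1, …, n`, as an element of `Λ(n, r)`. -/
def wt (k : Fin r → Fin n) : WComp n r :=
  ⟨letterCount k, by rw [sum_letterCount, Fintype.card_fin]⟩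

theorem wt_comp (k : Fin r → Fin n) (w : Equiv.Perm (Fin r)) : wt (k ∘ w) = wt k :=
  Subtype.ext (letterCount_comp_equiv k w)

theorem wt_iword (l : WComp n r) : wt (iword l) = l :=
  Subtype.ext ((letterCount_comp_equiv Sigma.fst
    ((finCongr l.2.symm).trans finSigmaFinEquiv.symm)).trans (letterCount_sigma_fst l.1))

theorem exists_comp_eq_of_wt_eq {k k' : Fin r → Fin n} (h : wt k = wt k') :
    ∃ w : Equiv.Perm (Fin r), k ∘ w = k' :=
  exists_comp_perm_eq (congrArg Subtype.val h)

theorem exists_iword_comp (k : Fin r → Fin n) : ∃ w : Equiv.Perm (Fin r), iword (wt k) ∘ w = k :=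
  exists_comp_eq_of_wt_eq (wt_iword _)

theorem eq_iword_of_monotone {k : Fin r → Fin n} (h : Monotone k) : k = iword (wt k) :=
  eq_of_monotone_of_letterCount_eq h (iword_monotone _)
    (congrArg Subtype.val (wt_iword (wt k)).symm)

/-- The matrix that counts the positions at which two words have a given pair of letters, as an
element of `M_n(r)`. -/
def nmat (k m : Fin r → Fin n) : NMat n r :=
  ⟨fun i j => letterCount (fun p => (k p, m p)) (i, j), by
    simp only [sum_letterCount_prod_right]
    exact (wt k).2⟩

theorem nmat_apply (k m : Fin r → Fin n) (i j : Fin n) :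
    (nmat k m).1 i j = letterCount (fun p => (k p, m p)) (i, j) := rfl

theorem nmat_eq_iff {k m k' m' : Fin r → Fin n} : nmat k m = nmat k' m' ↔
    letterCount (fun p => (k p, m p)) = letterCount (fun p => (k' p, m' p)) := by
  rw [Subtype.ext_iff, ← Matrix.ext_iff, funext_iff, Prod.forall]
  rfl

theorem nmat_comp (k m : Fin r → Fin n) (w : Equiv.Perm (Fin r)) :
    nmat (k ∘ w) (m ∘ w) = nmat k m :=
  nmat_eq_iff.2 (letterCount_comp_equiv (fun p => (k p, m p)) w)

theorem nmat_comp_left (k m : Fin r → Fin n) (w : Equiv.Perm (Fin r)) :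
    nmat (k ∘ w) m = nmat k (m ∘ w.symm) := by
  rw [← nmat_comp k _ w, Function.comp_assoc, Equiv.symm_comp_self, Function.comp_id]

theorem ro_nmat (k m : Fin r → Fin n) : ro (nmat k m) = wt k :=
  Subtype.ext (funext (sum_letterCount_prod_right k m))

theorem co_nmat (k m : Fin r → Fin n) : co (nmat k m) = wt m :=
  Subtype.ext (funext fun j => by
    simp only [co, nmat_apply, letterCount_swap k m]
    exact sum_letterCount_prod_right m k j)

theorem mem_coset_iff_nmat (A : NMat n r) (w : Equiv.Perm (Fin r)) :
    w ∈ coset A ↔ nmat (iword (ro A) ∘ w) (iword (co A)) = A := by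
  rw [mem_coset_iff, nmat_comp_left, Subtype.ext_iff, ← Matrix.ext_iff]
  simp only [nmat_apply, letterCount, Prod.mk.injEq]
  rfl

theorem exists_nmat_eq (A : NMat n r) : ∃ k : Fin r → Fin n, nmat k (iword (co A)) = A := by
  obtain ⟨k, hk⟩ := exists_letterCount_eq (r := r)
    (l := fun x : Fin n × Fin n => A.1 x.1 x.2) (by rw [Fintype.sum_prod_type]; exact A.2)
  have hA : nmat (fun p => (k p).1) (fun p => (k p).2) = A :=
    Subtype.ext (Matrix.ext fun i j => congrFun hk (i, j))
  have hwt : wt (fun p => (k p).2) = wt (iword (co A)) := by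
    rw [wt_iword, ← co_nmat (fun p => (k p).1), hA]
  obtain ⟨w, hw⟩ := exists_comp_eq_of_wt_eq hwt
  exact ⟨(fun p => (k p).1) ∘ w, by rw [← hw, nmat_comp, hA]⟩

theorem exists_comp_eq_of_nmat_eq {k k' m : Fin r → Fin n} (h : nmat k m = nmat k' m) :
    ∃ w : Equiv.Perm (Fin r), k ∘ w = k' ∧ m ∘ w = m := by
  obtain ⟨w, hw⟩ := exists_comp_perm_eq (nmat_eq_iff.1 h)
  exact ⟨w, funext fun p => congrArg Prod.fst (congrFun hw p),
    funext fun p => congrArg Prod.snd (congrFun hw p)⟩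

theorem eq_of_comp_perm_eq {α β γ : Type*} [LinearOrder α] {c : (Fin r → β) → γ} {m : Fin r → α}
    (hm : Monotone m) (hc : ∀ (i : Adj r) (k : Fin r → β), m i.lo = m i.hi →
      c (k ∘ simpleSwap i) = c k) (w : Equiv.Perm (Fin r)) (hw : m ∘ w = m) (k : Fin r → β) :
    c (k ∘ w) = c k := by
  induction w using perm_induction with
  | one => rfl
  | mul_simpleSwap w i hi ih =>
    have hlo : m (w i.hi) = m i.lo := by
      simpa only [coe_mul_simpleSwap, Function.comp, simpleSwap_lo] using congrFun hw i.lo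
    have hhi : m (w i.lo) = m i.hi := by
      simpa only [coe_mul_simpleSwap, Function.comp, simpleSwap_hi] using congrFun hw i.hi
    have hm_i : m i.lo = m i.hi := by
      refine (hm i.lo_lt_hi.le).antisymm ?_
      rw [← hlo, ← hhi]
      exact hm hi.le
    have hmw : m ∘ w = m := by
      rw [coe_mul_simpleSwap, ← Function.comp_assoc, comp_simpleSwap_eq_iff,
        comp_simpleSwap_eq_self hm_i] at hw
      exact hw
    rw [coe_mul_simpleSwap, ← Function.comp_assoc, hc i _ hm_i, ih hmw]

theorem eq_of_nmat_eq {γ : Type*} {c : (Fin r → Fin n) → γ} {m : Fin r → Fin n} (hm : Monotone m)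
    (hc : ∀ (i : Adj r) (k : Fin r → Fin n), m i.lo = m i.hi → c (k ∘ simpleSwap i) = c k)
    {k k' : Fin r → Fin n} (h : nmat k m = nmat k' m) : c k = c k' := by
  obtain ⟨w, rfl, hw⟩ := exists_comp_eq_of_nmat_eq h
  exact (eq_of_comp_perm_eq hm hc w hw k).symm

end Weights

/-! ### Reduced words -/

section Reduced

variable {r : ℕ} {M : Type*} [Monoid M]

/-- A family in a monoid that satisfies the braid relations of type A. The indexing type `Adj r` is
that of the simple transpositions of `Fin r`. -/
structure IsBraidFamily (T : Adj r → M) : Prop where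
  comm (i j : Adj r) (h : i.1 + 1 < j.1 ∨ j.1 + 1 < i.1) : T i * T j = T j * T i
  braid (i j : Adj r) (h : j.1 = i.1 + 1) : T i * T j * T i = T j * T i * T j

theorem isBraidFamily_simpleSwap : IsBraidFamily (simpleSwap : Adj r → Equiv.Perm (Fin r)) where
  comm i j h := (Equiv.Perm.disjoint_swap_swap (by simp [Adj.lo, Adj.hi]; omega)).commute
  braid i j h := by
    have hm : j.lo = i.hi := by simp [Adj.lo, Adj.hi, h]
    have hbc : i.hi ≠ j.hi := by simp [Adj.hi, h]
    have hac : i.lo ≠ j.hi := by simp [Adj.lo, Adj.hi, h]; omega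
    simp only [simpleSwap, hm]
    rw [Equiv.swap_mul_swap_mul_swap i.lo_lt_hi.ne hac, Equiv.swap_comm i.hi j.hi,
      Equiv.swap_comm i.lo i.hi, Equiv.swap_mul_swap_mul_swap hbc.symm hac.symm, Equiv.swap_comm]

theorem inversionCount_prod_le (L : List (Adj r)) :
    inversionCount (L.map simpleSwap).prod ≤ L.length := by
  induction L using List.reverseRecOn with
  | nil => exact (inversionCount_eq_zero monotone_id).le
  | append_singleton L i ih =>
    rw [List.map_append, List.prod_append, List.map_singleton, List.prod_singleton,
      coe_mul_simpleSwap, List.length_append, List.length_singleton]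
    exact (inversionCount_comp_simpleSwap_le _ i).trans (Nat.succ_le_succ ih)

theorem exists_word_length_eq_inversionCount (w : Equiv.Perm (Fin r)) :
    ∃ L : List (Adj r), (L.map simpleSwap).prod = w ∧ L.length = inversionCount w := by
  induction w using perm_induction with
  | one => exact ⟨[], rfl, (inversionCount_eq_zero monotone_id).symm⟩
  | mul_simpleSwap w i hi ih =>
    obtain ⟨L, rfl, hlen⟩ := ih
    refine ⟨L ++ [i], by simp, ?_⟩
    rw [coe_mul_simpleSwap, inversionCount_comp_simpleSwap_of_lt hi, ← hlen, List.length_append,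
      List.length_singleton]

theorem isReducedWord_iff {w : Equiv.Perm (Fin r)} {L : List (Adj r)} :
    IsReducedWord w L ↔ (L.map simpleSwap).prod = w ∧ L.length = inversionCount w := by
  refine and_congr_right fun hL => ⟨fun hmin => le_antisymm ?_ ?_, fun hlen L' hL' => ?_⟩
  · obtain ⟨L', hL', hlen⟩ := exists_word_length_eq_inversionCount w
    exact hlen ▸ hmin L' hL'
  · exact hL ▸ inversionCount_prod_le L
  · rw [hlen, ← hL']
    exact inversionCount_prod_le L'

theorem reducedWord_spec (w : Equiv.Perm (Fin r)) : IsReducedWord w (reducedWord w) :=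
  (exists_reducedWord w).choose_spec

theorem IsReducedWord.append {w : Equiv.Perm (Fin r)} {L : List (Adj r)} (h : IsReducedWord w L)
    {i : Adj r} (hi : w i.lo < w i.hi) : IsReducedWord (w * simpleSwap i) (L ++ [i]) := by
  rw [isReducedWord_iff] at h ⊢
  refine ⟨by simp [h.1], ?_⟩
  rw [coe_mul_simpleSwap, inversionCount_comp_simpleSwap_of_lt hi, List.length_append, h.2,
    List.length_singleton]

theorem IsReducedWord.append_of_descent {w : Equiv.Perm (Fin r)} {L : List (Adj r)} {i : Adj r}
    (h : IsReducedWord (w * simpleSwap i) L) (hi : w i.hi < w i.lo) :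
    IsReducedWord w (L ++ [i]) := by
  have := h.append (i := i) (by simpa [simpleSwap_lo, simpleSwap_hi] using hi)
  rwa [mul_assoc, simpleSwap_mul_self, mul_one] at this

theorem IsReducedWord.of_append {w : Equiv.Perm (Fin r)} {L : List (Adj r)} {i : Adj r}
    (h : IsReducedWord w (L ++ [i])) :
    w i.hi < w i.lo ∧ IsReducedWord (w * simpleSwap i) L := by
  obtain ⟨hprod, hlen⟩ := isReducedWord_iff.1 h
  have hL : (L.map simpleSwap).prod = w * simpleSwap i := by
    rw [← hprod]
    simp [mul_assoc, simpleSwap_mul_self]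
  have hle := inversionCount_prod_le L
  rw [hL, coe_mul_simpleSwap] at hle
  rw [List.length_append, List.length_singleton] at hlen
  have hi : w i.hi < w i.lo := by
    refine (lt_trichotomy _ _).resolve_right ?_
    rintro (heq | hlt)
    · exact i.lo_lt_hi.ne' (w.injective heq)
    · have := inversionCount_comp_simpleSwap_of_lt hlt
      omega
  refine ⟨hi, isReducedWord_iff.2 ⟨hL, ?_⟩⟩
  have := inversionCount_comp_simpleSwap_of_gt hi
  rw [coe_mul_simpleSwap]
  omega

theorem IsReducedWord.reverse {w : Equiv.Perm (Fin r)} {L : List (Adj r)} (h : IsReducedWord w L) :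
    IsReducedWord w⁻¹ L.reverse := by
  have hprod : ∀ L : List (Adj r),
      (L.reverse.map simpleSwap).prod = (L.map simpleSwap).prod⁻¹ := by
    intro L
    rw [List.prod_inv_reverse, List.map_reverse, List.map_map]
    rfl
  refine ⟨by rw [hprod, h.1], fun L' hL' => ?_⟩
  simpa using h.2 L'.reverse (by rw [hprod, hL', inv_inv])

namespace IsBraidFamily

variable {T : Adj r → M} {w : Equiv.Perm (Fin r)} {i j : Adj r}

theorem exists_reducedWords_of_far (hT : IsBraidFamily T) (hi : w i.hi < w i.lo)
    (hj : w j.hi < w j.lo) (hij : i.1 + 1 < j.1 ∨ j.1 + 1 < i.1) :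
    ∃ L L' : List (Adj r), IsReducedWord (w * simpleSwap i) L ∧
      IsReducedWord (w * simpleSwap j) L' ∧ (L.map T).prod * T i = (L'.map T).prod * T j := by
  obtain ⟨hll, hlh, hhl, hhh⟩ : i.lo ≠ j.lo ∧ i.lo ≠ j.hi ∧ i.hi ≠ j.lo ∧ i.hi ≠ j.hi := by
    simp only [Adj.lo, Adj.hi, ne_eq, Fin.mk.injEq]
    omega
  obtain ⟨K, hK⟩ := exists_reducedWord (w * simpleSwap i * simpleSwap j)
  have hK' : IsReducedWord (w * simpleSwap j * simpleSwap i) K := by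
    rwa [mul_assoc, ← isBraidFamily_simpleSwap.comm i j hij, ← mul_assoc]
  refine ⟨K ++ [j], K ++ [i], hK.append_of_descent ?_, hK'.append_of_descent ?_, ?_⟩
  · simpa [simpleSwap_of_ne hll.symm hhl.symm, simpleSwap_of_ne hlh.symm hhh.symm] using hj
  · simpa [simpleSwap_of_ne hll hlh, simpleSwap_of_ne hhl hhh] using hi
  · simp [mul_assoc, hT.comm i j hij]

theorem exists_reducedWords_of_adjacent (hT : IsBraidFamily T) (hi : w i.hi < w i.lo)
    (hj : w j.hi < w j.lo) (hij : j.1 = i.1 + 1) :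
    ∃ L L' : List (Adj r), IsReducedWord (w * simpleSwap i) L ∧
      IsReducedWord (w * simpleSwap j) L' ∧ (L.map T).prod * T i = (L'.map T).prod * T j := by
  have hm : j.lo = i.hi := by simp [Adj.lo, Adj.hi, hij]
  have hhh : i.hi ≠ j.hi := by simp [Adj.hi, hij]
  have hlh : i.lo ≠ j.hi := by simp [Adj.lo, Adj.hi, hij]; omega
  have hs_lo : simpleSwap j i.lo = i.lo := simpleSwap_of_ne (hm ▸ i.lo_lt_hi.ne) hlh
  have hs_hi : simpleSwap i j.hi = j.hi := simpleSwap_of_ne hlh.symm hhh.symm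
  have hs_mid : simpleSwap j i.hi = j.hi := hm ▸ simpleSwap_lo j
  have hs_mid' : simpleSwap j j.hi = i.hi := hm ▸ simpleSwap_hi j
  rw [hm] at hj
  obtain ⟨K, hK⟩ := exists_reducedWord (w * simpleSwap i * simpleSwap j * simpleSwap i)
  have hK' : IsReducedWord (w * simpleSwap j * simpleSwap i * simpleSwap j) K := by
    simpa only [mul_assoc, isBraidFamily_simpleSwap.braid i j hij] using hK
  refine ⟨K ++ [i] ++ [j], K ++ [j] ++ [i],
    (hK.append_of_descent ?_).append_of_descent ?_,
    (hK'.append_of_descent ?_).append_of_descent ?_, ?_⟩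
  · simpa [simpleSwap_lo, simpleSwap_hi, hs_lo, hs_hi, hs_mid] using hj
  · simpa [simpleSwap_hi, hs_hi, hm] using hj.trans hi
  · simpa [simpleSwap_lo, simpleSwap_hi, hs_lo, hs_hi, hs_mid', hm] using hi
  · simpa [hs_lo, hs_mid] using hj.trans hi
  · have := hT.braid i j hij
    simp only [mul_assoc] at this
    simp [mul_assoc, this]

theorem exists_reducedWords_of_descents (hT : IsBraidFamily T) (hi : w i.hi < w i.lo)
    (hj : w j.hi < w j.lo) :
    ∃ L L' : List (Adj r), IsReducedWord (w * simpleSwap i) L ∧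
      IsReducedWord (w * simpleSwap j) L' ∧ (L.map T).prod * T i = (L'.map T).prod * T j := by
  rcases eq_or_ne i j with rfl | hne
  · obtain ⟨L, hL⟩ := exists_reducedWord (w * simpleSwap i)
    exact ⟨L, L, hL, hL, rfl⟩
  have hne' : i.1 ≠ j.1 := fun h => hne (Subtype.ext h)
  by_cases hij : j.1 = i.1 + 1
  · exact hT.exists_reducedWords_of_adjacent hi hj hij
  by_cases hji : i.1 = j.1 + 1
  · obtain ⟨L, L', hL, hL', h⟩ := hT.exists_reducedWords_of_adjacent hj hi hji
    exact ⟨L', L, hL', hL, h.symm⟩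
  · exact hT.exists_reducedWords_of_far hi hj (by omega)

/-- Matsumoto's theorem for the symmetric group. -/
theorem prod_eq_of_isReducedWord (hT : IsBraidFamily T) {L L' : List (Adj r)}
    (h : IsReducedWord w L) (h' : IsReducedWord w L') : (L.map T).prod = (L'.map T).prod := by
  induction hm : L.length generalizing w L L' with
  | zero =>
    have hlen := (isReducedWord_iff.1 h).2.trans (isReducedWord_iff.1 h').2.symm
    rw [List.eq_nil_of_length_eq_zero hm, List.eq_nil_of_length_eq_zero (hlen.symm.trans hm)]
  | succ m ih =>
    have hlen := (isReducedWord_iff.1 h).2.trans (isReducedWord_iff.1 h').2.symm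
    obtain rfl | ⟨L, i, rfl⟩ := List.eq_nil_or_concat' L
    · simp at hm
    obtain rfl | ⟨L', j, rfl⟩ := List.eq_nil_or_concat' L'
    · simp at hlen
    simp only [List.length_append, List.length_singleton, Nat.add_right_cancel_iff] at hm hlen
    obtain ⟨hi, hL⟩ := h.of_append
    obtain ⟨hj, hL'⟩ := h'.of_append
    obtain ⟨K, K', hK, hK', hKK'⟩ := hT.exists_reducedWords_of_descents hi hj
    simpa [ih hL hK hm, ih hL' hK' (hlen.symm.trans hm)] using hKK'

end IsBraidFamily

end Reduced

/-! ### The basis `T_w` of the Hecke algebra -/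

section HeckeBasis

variable (R : Type) [CommRing R] (q : R) {n r : ℕ}

theorem Hecke.isBraidFamily_T : IsBraidFamily (Hecke.T R q (r := r)) where
  comm := Hecke.T_comm R q
  braid := Hecke.T_braid R q

theorem Hecke.Tw_eq {w : Equiv.Perm (Fin r)} {L : List (Adj r)} (h : IsReducedWord w L) :
    Hecke.Tw R q w = (L.map (Hecke.T R q)).prod :=
  (Hecke.isBraidFamily_T R q).prod_eq_of_isReducedWord (reducedWord_spec w) h

theorem Hecke.Tw_one : Hecke.Tw R q (1 : Equiv.Perm (Fin r)) = 1 :=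
  Hecke.Tw_eq R q (L := []) ⟨rfl, fun _ _ => Nat.zero_le _⟩

theorem Hecke.Tw_mul_T_of_lt {w : Equiv.Perm (Fin r)} {i : Adj r} (h : w i.lo < w i.hi) :
    Hecke.Tw R q w * Hecke.T R q i = Hecke.Tw R q (w * simpleSwap i) := by
  rw [Hecke.Tw_eq R q ((reducedWord_spec w).append h), Hecke.Tw]
  simp

/-- The anti-automorphism of the Hecke algebra that fixes the generators. -/
def Hecke.rev : Hecke R q r →ₐ[R] (Hecke R q r)ᵐᵒᵖ :=
  RingQuot.liftAlgHom R ⟨FreeAlgebra.lift R fun i => MulOpposite.op (Hecke.T R q i), by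
    intro x y h
    apply MulOpposite.unop_injective
    induction h with
    | quad i => simpa using Hecke.T_quad R q i
    | comm i j h => simpa using (Hecke.T_comm R q i j h).symm
    | braid i j h => simpa [mul_assoc] using Hecke.T_braid R q i j h⟩

theorem Hecke.rev_T (i : Adj r) : Hecke.rev R q (Hecke.T R q i) = MulOpposite.op (Hecke.T R q i) :=
  (RingQuot.liftAlgHom_mkAlgHom_apply ..).trans (FreeAlgebra.lift_ι_apply _ _)

theorem Hecke.rev_Tw (w : Equiv.Perm (Fin r)) :
    Hecke.rev R q (Hecke.Tw R q w) = MulOpposite.op (Hecke.Tw R q w⁻¹) := by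
  rw [Hecke.Tw_eq R q (reducedWord_spec w).reverse, Hecke.Tw, map_list_prod,
    ← MulOpposite.unop_inj, MulOpposite.unop_op, MulOpposite.unop_list_prod, List.map_map,
    List.map_map, List.map_reverse]
  congr 2
  refine List.map_congr_left fun i _ => ?_
  simp [Hecke.rev_T]

variable {R q}

theorem Hecke.induction {P : Hecke R q r → Prop} (algebraMap : ∀ c : R, P (algebraMap R _ c))
    (T : ∀ i, P (Hecke.T R q i)) (mul : ∀ x y, P x → P y → P (x * y))
    (add : ∀ x y, P x → P y → P (x + y)) (x : Hecke R q r) : P x := by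
  obtain ⟨y, rfl⟩ := RingQuot.mkAlgHom_surjective R (HeckeRel R q r) x
  induction y using FreeAlgebra.induction with
  | grade0 c =>
    rw [AlgHom.commutes]
    exact algebraMap c
  | grade1 i => exact T i
  | mul a b ha hb =>
    rw [map_mul]
    exact mul _ _ ha hb
  | add a b ha hb =>
    rw [map_add]
    exact add _ _ ha hb

/-- The homomorphism of right modules over the Hecke algebra given by an `R`-linear map that
commutes with the action of the generators. -/
def heckeLinearMap {M N : Type*} [AddCommGroup M] [Module R M] [Module (Hecke R q r)ᵐᵒᵖ M]
    [IsScalarTower R (Hecke R q r)ᵐᵒᵖ M] [AddCommGroup N] [Module R N]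
    [Module (Hecke R q r)ᵐᵒᵖ N] [IsScalarTower R (Hecke R q r)ᵐᵒᵖ N] (f : M →ₗ[R] N)
    (hf : ∀ (i : Adj r) (m : M),
      f (MulOpposite.op (Hecke.T R q i) • m) = MulOpposite.op (Hecke.T R q i) • f m) :
    M →ₗ[(Hecke R q r)ᵐᵒᵖ] N where
  toFun := f
  map_add' := map_add f
  map_smul' h m := by
    induction h using MulOpposite.rec' with | _ h
    induction h using Hecke.induction generalizing m with
    | algebraMap c =>
      have hc : MulOpposite.op (algebraMap R (Hecke R q r) c) = c • (1 : (Hecke R q r)ᵐᵒᵖ) := by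
        rw [Algebra.algebraMap_eq_smul_one, MulOpposite.op_smul, MulOpposite.op_one]
      simp only [hc, smul_assoc, one_smul, map_smul, RingHom.id_apply]
    | T i => exact hf i m
    | mul x y hx hy => simp only [MulOpposite.op_mul, mul_smul, hy, hx, RingHom.id_apply]
    | add x y hx hy => simp only [MulOpposite.op_add, add_smul, map_add, hx, hy, RingHom.id_apply]

instance : IsScalarTower R (Hecke R q r)ᵐᵒᵖ (TSpace R n r) where
  smul_assoc c h v := by
    change (heckeAct R q (n := n) (c • h.unop)).unop v = c • (heckeAct R q (n := n) h.unop).unop v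
    rw [map_smul]
    rfl

variable (R q)

theorem actT_ξ_of_lt {i : Adj r} {k : Fin r → Fin n} (h : k i.lo < k i.hi) :
    actT R q i (ξ R k) = ξ R (k ∘ simpleSwap i) := by
  rw [actT_ξ, if_pos h]

theorem actT_ξ_of_eq {i : Adj r} {k : Fin r → Fin n} (h : k i.lo = k i.hi) :
    actT R q i (ξ R k) = q • ξ R k := by
  rw [actT_ξ, if_neg h.not_lt, if_pos h]

theorem actT_ξ_of_gt {i : Adj r} {k : Fin r → Fin n} (h : k i.hi < k i.lo) :
    actT R q i (ξ R k) = q • ξ R (k ∘ simpleSwap i) + (q - 1) • ξ R k := by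
  rw [actT_ξ, if_neg h.not_gt, if_neg h.ne']

theorem op_Tw_smul_ξ_id (w : Equiv.Perm (Fin r)) :
    MulOpposite.op (Hecke.Tw R q w) • ξ R (id : Fin r → Fin r) = ξ R (w : Fin r → Fin r) := by
  induction w using perm_induction with
  | one =>
    rw [Hecke.Tw_one, MulOpposite.op_one, one_smul]
    rfl
  | mul_simpleSwap w i hi ih =>
    rw [← Hecke.Tw_mul_T_of_lt R q hi, MulOpposite.op_mul, mul_smul, ih, op_T_smul,
      actT_ξ_of_lt R q hi, coe_mul_simpleSwap]

theorem linearIndependent_Tw : LinearIndependent R (Hecke.Tw R q (r := r)) := by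
  let act : Hecke R q r →ₗ[R] TSpace R r r :=
    (LinearMap.toSpanSingleton (Hecke R q r)ᵐᵒᵖ (TSpace R r r) (ξ R id)).restrictScalars R ∘ₗ
      (MulOpposite.opLinearEquiv R).toLinearMap
  have hact : ⇑act ∘ Hecke.Tw R q = ⇑(ξ R) ∘ ((⇑) : Equiv.Perm (Fin r) → Fin r → Fin r) :=
    funext (op_Tw_smul_ξ_id R q)
  refine LinearIndependent.of_comp act ?_
  rw [hact]
  exact (ξ R).linearIndependent.comp _ DFunLike.coe_injective

end HeckeBasis

/-! ### The permutation module as a tensor space -/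

section Perm

variable (R : Type) [CommRing R] (q : R) {n r : ℕ}

theorem comp_mul_simpleSwap_eq_iff {β : Type*} {f k : Fin r → β} {w : Equiv.Perm (Fin r)}
    {i : Adj r} : f ∘ ⇑(w * simpleSwap i) = k ↔ f ∘ w = k ∘ simpleSwap i := by
  rw [coe_mul_simpleSwap, ← Function.comp_assoc, comp_simpleSwap_eq_iff]

/-- The sum of the `T_w` over all `w` that transform the weakly increasing word of weight `l` into
`k`. -/
def wordSum (l : WComp n r) (k : Fin r → Fin n) : Hecke R q r :=
  ∑ w ∈ Finset.univ.filter (fun w : Equiv.Perm (Fin r) => iword l ∘ w = k), Hecke.Tw R q w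

theorem wordSum_mul_T_of_lt (l : WComp n r) {k : Fin r → Fin n} {i : Adj r}
    (h : k i.lo < k i.hi) :
    wordSum R q l k * Hecke.T R q i = wordSum R q l (k ∘ simpleSwap i) := by
  rw [wordSum, wordSum, Finset.sum_mul]
  refine Finset.sum_equiv (Equiv.mulRight (simpleSwap i)) (fun w => ?_) fun w hw => ?_
  · simp only [Finset.mem_filter, Finset.mem_univ, true_and, Equiv.coe_mulRight,
      comp_mul_simpleSwap_eq_iff, comp_simpleSwap_comp_simpleSwap]
  · obtain rfl := (Finset.mem_filter.1 hw).2
    exact Hecke.Tw_mul_T_of_lt R q ((iword_monotone l).reflect_lt h)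

theorem wordSum_eq_mul_one_add_T (l : WComp n r) {k : Fin r → Fin n} {i : Adj r}
    (h : k i.lo = k i.hi) :
    wordSum R q l k = (∑ w ∈ Finset.univ.filter (fun w : Equiv.Perm (Fin r) =>
      iword l ∘ w = k ∧ w i.lo < w i.hi), Hecke.Tw R q w) * (1 + Hecke.T R q i) := by
  rw [mul_add, mul_one, wordSum, ← Finset.sum_filter_add_sum_filter_not _
    (fun w : Equiv.Perm (Fin r) => w i.lo < w i.hi), Finset.filter_filter, Finset.filter_filter,
    Finset.sum_mul]
  congr 1
  symm
  refine Finset.sum_equiv (Equiv.mulRight (simpleSwap i)) (fun w => ?_) fun w hw => ?_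
  · simp only [Finset.mem_filter, Finset.mem_univ, true_and, Equiv.coe_mulRight,
      comp_mul_simpleSwap_eq_iff, comp_simpleSwap_eq_self h, Equiv.Perm.mul_apply, simpleSwap_lo,
      simpleSwap_hi, not_lt]
    exact and_congr_right fun _ => (w.injective.ne i.lo_lt_hi.ne).le_iff_lt.symm
  · exact Hecke.Tw_mul_T_of_lt R q (Finset.mem_filter.1 hw).2.2

theorem wordSum_mul_T_of_eq (l : WComp n r) {k : Fin r → Fin n} {i : Adj r}
    (h : k i.lo = k i.hi) :
    wordSum R q l k * Hecke.T R q i = q • wordSum R q l k := by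
  have hT : (1 + Hecke.T R q i) * Hecke.T R q i = q • (1 + Hecke.T R q i) := by
    rw [add_mul, one_mul, Hecke.T_quad, Algebra.algebraMap_eq_smul_one]
    module
  rw [wordSum_eq_mul_one_add_T R q l h, mul_assoc, hT, mul_smul_comm]

theorem wordSum_mul_T_of_gt (l : WComp n r) {k : Fin r → Fin n} {i : Adj r}
    (h : k i.hi < k i.lo) :
    wordSum R q l k * Hecke.T R q i =
      q • wordSum R q l (k ∘ simpleSwap i) + (q - 1) • wordSum R q l k := by
  have hk : wordSum R q l (k ∘ simpleSwap i) * Hecke.T R q i = wordSum R q l k := by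
    rw [wordSum_mul_T_of_lt R q l (by simpa [simpleSwap_lo, simpleSwap_hi] using h),
      comp_simpleSwap_comp_simpleSwap]
  rw [← hk, mul_assoc, Hecke.T_quad, Algebra.algebraMap_eq_smul_one, mul_add, mul_smul_comm,
    mul_smul_comm, mul_one, add_comm]

open Classical in
theorem wordSum_iword (l m : WComp n r) :
    wordSum R q l (iword m) = if m = l then xsum R q l else 0 := by
  split_ifs with h
  · subst h
    rw [wordSum, xsum]
    refine Finset.sum_congr (Finset.filter_congr fun w _ => ?_) fun _ _ => rfl
    rw [funext_iff]
    rfl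
  · rw [wordSum, Finset.filter_eq_empty_iff.2, Finset.sum_empty]
    intro w _ hw
    apply h
    rw [← wt_iword m, ← hw, wt_comp, wt_iword]

theorem wordSum_mem (l : WComp n r) (k : Fin r → Fin n) : wordSum R q l k ∈ xH R q l := by
  induction k using word_induction with
  | mono k hk =>
    rw [eq_iword_of_monotone hk, wordSum_iword]
    split_ifs
    · exact Submodule.subset_span rfl
    · exact zero_mem _
  | step k i h ih =>
    rw [← wordSum_mul_T_of_lt R q l h]
    exact (xH R q l).smul_mem (MulOpposite.op (Hecke.T R q i)) ih

/-- The homomorphism from the tensor space to the Hecke algebra that sends the increasing word of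
weight `l` to `x_l` and all other increasing words to `0`. -/
def wordMap (l : WComp n r) : TSpace R n r →ₗ[(Hecke R q r)ᵐᵒᵖ] Hecke R q r :=
  heckeLinearMap ((ξ R).constr R (wordSum R q l)) fun i v => by
    suffices h : (ξ R).constr R (wordSum R q l) ∘ₗ actT R q i =
        LinearMap.mulRight R (Hecke.T R q i) ∘ₗ (ξ R).constr R (wordSum R q l) by
      rw [op_T_smul]
      exact DFunLike.congr_fun h v
    refine (ξ R).ext fun k => ?_
    simp only [LinearMap.comp_apply, LinearMap.mulRight_apply, Module.Basis.constr_basis]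
    rcases lt_trichotomy (k i.lo) (k i.hi) with h | h | h
    · rw [actT_ξ_of_lt R q h, wordSum_mul_T_of_lt R q l h, Module.Basis.constr_basis]
    · rw [actT_ξ_of_eq R q h, wordSum_mul_T_of_eq R q l h, map_smul, Module.Basis.constr_basis]
    · rw [actT_ξ_of_gt R q h, wordSum_mul_T_of_gt R q l h, map_add, map_smul, map_smul,
        Module.Basis.constr_basis, Module.Basis.constr_basis]

theorem wordMap_ξ (l : WComp n r) (k : Fin r → Fin n) : wordMap R q l (ξ R k) = wordSum R q l k :=
  (ξ R).constr_basis R _ k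

theorem wordMap_eq_sum_wordSum (l : WComp n r) (v : TSpace R n r) :
    wordMap R q l v = ∑ k, (ξ R).repr v k • wordSum R q l k :=
  (ξ R).constr_apply_fintype R _ v

theorem wordMap_eq_sum_Tw (l : WComp n r) (v : TSpace R n r) :
    wordMap R q l v = ∑ w : Equiv.Perm (Fin r), (ξ R).repr v (iword l ∘ w) • Hecke.Tw R q w := by
  rw [wordMap_eq_sum_wordSum,
    ← Finset.sum_fiberwise (s := Finset.univ) (g := fun w : Equiv.Perm (Fin r) => iword l ∘ w)]
  refine Finset.sum_congr rfl fun k _ => ?_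
  rw [wordSum, Finset.smul_sum]
  exact Finset.sum_congr rfl fun w hw => by rw [(Finset.mem_filter.1 hw).2]

theorem wordMap_mem (l : WComp n r) (v : TSpace R n r) : wordMap R q l v ∈ xH R q l := by
  rw [wordMap_eq_sum_wordSum]
  exact Submodule.sum_mem _ fun k _ => Submodule.smul_of_tower_mem _ _ (wordSum_mem R q l k)

/-- The homomorphism from the tensor space to the permutation module that sends the increasing word
of weight `l` to `x_l`. -/
def permMap : TSpace R n r →ₗ[(Hecke R q r)ᵐᵒᵖ] PermMod R q n r :=
  (DirectSum.linearEquivFunOnFintype (Hecke R q r)ᵐᵒᵖ (WComp n r)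
    (fun l => xH R q l)).symm.toLinearMap.comp
      (LinearMap.pi fun l => (wordMap R q l).codRestrict (xH R q l) (wordMap_mem R q l))

theorem coe_permMap_apply (v : TSpace R n r) (l : WComp n r) :
    ((permMap R q v l : xH R q l) : Hecke R q r) = wordMap R q l v :=
  congrArg Subtype.val (congrFun ((DirectSum.linearEquivFunOnFintype (Hecke R q r)ᵐᵒᵖ (WComp n r)
    (fun l => xH R q l)).apply_symm_apply
      (LinearMap.pi (fun l => (wordMap R q l).codRestrict (xH R q l) (wordMap_mem R q l)) v)) l)

variable {R q} in
theorem permMod_ext {x y : PermMod R q n r}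
    (h : ∀ l, ((x l : xH R q l) : Hecke R q r) = (y l : xH R q l)) : x = y :=
  DFinsupp.ext fun l => Subtype.ext (h l)

theorem coe_of_apply (l m : WComp n r) (x : xH R q l) :
    ((DirectSum.of (fun l => xH R q l) l x m : xH R q m) : Hecke R q r) =
      if l = m then (x : Hecke R q r) else 0 := by
  split_ifs with h
  · subst h
    rw [DirectSum.of_eq_same]
  · rw [DirectSum.of_eq_of_ne _ _ _ (Ne.symm h)]
    rfl

theorem coe_gen_apply (l m : WComp n r) :
    ((gen R q l m : xH R q m) : Hecke R q r) = if l = m then xsum R q l else 0 :=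
  coe_of_apply R q l m _

theorem permMap_ξ_iword (l : WComp n r) : permMap R q (ξ R (iword l)) = gen R q l := by
  refine permMod_ext fun m => ?_
  rw [coe_permMap_apply, wordMap_ξ, wordSum_iword, coe_gen_apply]
  split_ifs with h
  · rw [h]
  · rfl

theorem span_gen : Submodule.span (Hecke R q r)ᵐᵒᵖ (Set.range (gen R q (n := n) (r := r))) = ⊤ := by
  rw [eq_top_iff]
  rintro x -
  induction x using DirectSum.induction_on with
  | zero => exact zero_mem _
  | of l x =>
    obtain ⟨x, hx⟩ := x
    obtain ⟨h, rfl⟩ := Submodule.mem_span_singleton.1 hx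
    have hsmul : DirectSum.of (fun l : WComp n r => xH R q l) l ⟨h • xsum R q l, hx⟩ =
        h • gen R q l :=
      (DirectSum.lof (Hecke R q r)ᵐᵒᵖ _ (fun l : WComp n r => xH R q l) l).map_smul h
        ⟨xsum R q l, Submodule.subset_span (Set.mem_singleton _)⟩
    rw [hsmul]
    exact Submodule.smul_mem _ _ (Submodule.subset_span ⟨l, rfl⟩)
  | add x y hx hy => exact add_mem hx hy

theorem permMap_injective : Function.Injective (permMap R q (n := n) (r := r)) := by
  rw [injective_iff_map_eq_zero]
  intro v hv
  refine (ξ R).ext_elem fun k => ?_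
  obtain ⟨w, hw⟩ := exists_iword_comp k
  have hsum := coe_permMap_apply R q v (wt k)
  rw [hv, wordMap_eq_sum_Tw] at hsum
  rw [← hw, Fintype.linearIndependent_iff.1 (linearIndependent_Tw R q) _ hsum.symm w, map_zero,
    Finsupp.zero_apply]

theorem permMap_surjective : Function.Surjective (permMap R q (n := n) (r := r)) := by
  rw [← LinearMap.range_eq_top, eq_top_iff, ← span_gen, Submodule.span_le]
  rintro _ ⟨l, rfl⟩
  exact ⟨_, permMap_ξ_iword R q l⟩

/-- The isomorphism of the permutation module with the tensor space that sends `x_l` to the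
increasing word of weight `l`. -/
def permEquiv : PermMod R q n r ≃ₗ[(Hecke R q r)ᵐᵒᵖ] TSpace R n r :=
  (LinearEquiv.ofBijective _ ⟨permMap_injective R q, permMap_surjective R q⟩).symm

theorem permEquiv_gen (l : WComp n r) : permEquiv R q (gen R q l) = ξ R (iword l) := by
  rw [permEquiv, LinearEquiv.symm_apply_eq]
  exact (permMap_ξ_iword R q l).symm

theorem permEquiv_smul (c : R) (x : PermMod R q n r) :
    permEquiv R q (c • x) = c • permEquiv R q x :=
  (permEquiv R q).toLinearMap.map_smul_of_tower c x

theorem permEquiv_symm_apply (v : TSpace R n r) : (permEquiv R q).symm v = permMap R q v := rfl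

end Perm

/-! ### The standard basis of the Schur algebra -/

section Std

variable (R : Type) [CommRing R] (q : R) {n r : ℕ}

/-- The sum of the words whose matrix relative to the increasing word of weight `co A` is `A`: the
tensor that corresponds to the sum of the `T_w` over the double coset of `A`. -/
def orb (A : NMat n r) : TSpace R n r :=
  ∑ k ∈ Finset.univ.filter (fun k => nmat k (iword (co A)) = A), ξ R k

theorem repr_orb (A : NMat n r) (k : Fin r → Fin n) :
    (ξ R).repr (orb R A) k = if nmat k (iword (co A)) = A then 1 else 0 := by
  simp [orb, Finsupp.single_apply]

theorem coe_permMap_orb (A : NMat n r) (l : WComp n r) :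
    ((permMap R q (orb R A) l : xH R q l) : Hecke R q r) =
      if l = ro A then cosetSum R q A else 0 := by
  classical
  simp only [coe_permMap_apply, wordMap_eq_sum_Tw, repr_orb, ite_smul, one_smul, zero_smul]
  rw [← Finset.sum_filter]
  split_ifs with h
  · subst h
    exact Finset.sum_congr
      (Finset.filter_congr fun w _ => (mem_coset_iff_nmat A w).symm) fun _ _ => rfl
  · refine Finset.sum_eq_zero fun w hw => absurd ?_ h
    rw [← (Finset.mem_filter.1 hw).2, ro_nmat, wt_comp, wt_iword]

theorem cosetSum_mem (A : NMat n r) : cosetSum R q A ∈ xH R q (ro A) := by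
  have hA := coe_permMap_orb R q A (ro A)
  rw [if_pos rfl] at hA
  exact hA ▸ Subtype.coe_prop _

theorem isStd_iff (A : NMat n r) (φ : Schur R q n r) :
    IsStd R q A φ ↔ ∀ l, φ (gen R q l) = if l = co A then permMap R q (orb R A) else 0 := by
  refine forall_congr' fun l => ?_
  by_cases h : l = co A
  · simp only [h, true_and, if_true, ← coe_permMap_orb]
    exact ⟨permMod_ext, fun hφ m => by rw [hφ]⟩
  · simp only [h, false_and, if_false]
    exact ⟨fun hφ => permMod_ext hφ, fun hφ m => by rw [hφ]; rfl⟩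

/-- The transpose of an element of `M_n(r)`. -/
def transpose (A : NMat n r) : NMat n r :=
  ⟨A.1.transpose, Finset.sum_comm.trans A.2⟩

theorem nmat_swap (k m : Fin r → Fin n) : nmat m k = transpose (nmat k m) :=
  Subtype.ext (Matrix.ext fun i j => letterCount_swap m k i j)

theorem transpose_injective : Function.Injective (transpose (n := n) (r := r)) := fun _ _ h =>
  Subtype.ext (Matrix.transpose_injective (congrArg Subtype.val h))

theorem inv_mem_coset_transpose (A : NMat n r) (w : Equiv.Perm (Fin r)) :
    w⁻¹ ∈ coset (transpose A) ↔ w ∈ coset A := by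
  rw [mem_coset_iff_nmat, mem_coset_iff_nmat, nmat_comp_left, nmat_swap,
    transpose_injective.eq_iff]
  rfl

theorem rev_cosetSum (A : NMat n r) :
    Hecke.rev R q (cosetSum R q (transpose A)) = MulOpposite.op (cosetSum R q A) := by
  simp only [cosetSum, map_sum, Hecke.rev_Tw, Finset.op_sum]
  refine Finset.sum_equiv (Equiv.inv _) (fun w => ?_) fun _ _ => rfl
  simp only [Finset.mem_filter, Finset.mem_univ, true_and, Equiv.inv_apply]
  rw [← inv_mem_coset_transpose A, inv_inv]

theorem rev_xsum (l : WComp n r) :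
    Hecke.rev R q (xsum R q l) = MulOpposite.op (xsum R q l) := by
  simp only [xsum, map_sum, Hecke.rev_Tw, Finset.op_sum]
  refine Finset.sum_equiv (Equiv.inv _) (fun w => ?_) fun _ _ => rfl
  simp

-- The double coset sum of the transpose lies in the right ideal of `x_{co A}`; reverse all words.
theorem exists_mul_xsum_eq_cosetSum (A : NMat n r) :
    ∃ h : Hecke R q r, h * xsum R q (co A) = cosetSum R q A := by
  obtain ⟨h, hh⟩ := Submodule.mem_span_singleton.1 (cosetSum_mem R q (transpose A))
  have hrev := congrArg (Hecke.rev R q) hh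
  rw [rev_cosetSum, MulOpposite.smul_eq_mul_unop, map_mul, rev_xsum] at hrev
  exact ⟨(Hecke.rev R q h.unop).unop, congrArg MulOpposite.unop hrev⟩

variable {R q} in
/-- Left multiplication by an element `h` with `h x_l ∈ x_m H`, as a homomorphism of right ideals
`x_l H → x_m H`. -/
def mulLeftMap {l m : WComp n r} (h : Hecke R q r) (hh : h * xsum R q l ∈ xH R q m) :
    xH R q l →ₗ[(Hecke R q r)ᵐᵒᵖ] xH R q m :=
  (DistribSMul.toLinearMap (Hecke R q r)ᵐᵒᵖ (Hecke R q r) h).restrict fun x hx => by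
    obtain ⟨y, rfl⟩ := Submodule.mem_span_singleton.1 hx
    rw [map_smul]
    exact Submodule.smul_mem _ y hh

theorem exists_isStd (A : NMat n r) : ∃ φ, IsStd R q A φ := by
  obtain ⟨h, hh⟩ := exists_mul_xsum_eq_cosetSum R q A
  have hmem : h * xsum R q (co A) ∈ xH R q (ro A) := hh ▸ cosetSum_mem R q A
  refine ⟨DirectSum.lof (Hecke R q r)ᵐᵒᵖ _ (fun l : WComp n r => xH R q l) (ro A) ∘ₗ
    mulLeftMap h hmem ∘ₗ DirectSum.component (Hecke R q r)ᵐᵒᵖ _ (fun l : WComp n r => xH R q l)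
      (co A), fun l m => ?_⟩
  refine (coe_of_apply R q (ro A) m (mulLeftMap h hmem (gen R q l (co A)))).trans ?_
  have hgen : ((mulLeftMap h hmem (gen R q l (co A)) : xH R q (ro A)) : Hecke R q r) =
      if l = co A then cosetSum R q A else 0 := by
    change h * ((gen R q l (co A) : xH R q (co A)) : Hecke R q r) = _
    rw [coe_gen_apply, mul_ite, mul_zero]
    split_ifs with hl
    · rw [hl, hh]
    · rfl
  rw [hgen, ← ite_and]
  simp only [eq_comm (a := m), and_comm]

theorem isStd_std (A : NMat n r) : IsStd R q A (std R q A) := by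
  rw [std, dif_pos (exists_isStd R q A)]
  exact (exists_isStd R q A).choose_spec

theorem permEquiv_std_gen (A : NMat n r) (l : WComp n r) :
    permEquiv R q (std R q A (gen R q l)) = if l = co A then orb R A else 0 := by
  rw [(isStd_iff R q A _).1 (isStd_std R q A) l]
  split_ifs
  · rw [← permEquiv_symm_apply, LinearEquiv.apply_symm_apply]
  · exact map_zero _

variable {R q} in
theorem schur_ext {s t : Schur R q n r} (h : ∀ l, s (gen R q l) = t (gen R q l)) : s = t :=
  LinearMap.ext_on (span_gen R q) (by rintro _ ⟨l, rfl⟩; exact h l)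

theorem repr_actT_of_gt {k : Fin r → Fin n} {i : Adj r} (h : k i.hi < k i.lo) (v : TSpace R n r) :
    (ξ R).repr (actT R q i v) k =
      (ξ R).repr v (k ∘ simpleSwap i) + (q - 1) * (ξ R).repr v k := by
  suffices hcoord : (ξ R).coord k ∘ₗ actT R q i =
      (ξ R).coord (k ∘ simpleSwap i) + (q - 1) • (ξ R).coord k from
    DFunLike.congr_fun hcoord v
  have hcoord_ξ : ∀ k₁ k₂ : Fin r → Fin n, (ξ R).coord k₁ (ξ R k₂) = if k₂ = k₁ then 1 else 0 :=
    fun k₁ k₂ => by rw [Module.Basis.coord_apply, Module.Basis.repr_self, Finsupp.single_apply]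
  refine (ξ R).ext fun m => ?_
  have hm : m = k → m i.hi < m i.lo := by
    rintro rfl
    exact h
  have hm_swap : m = k ∘ simpleSwap i → m i.lo < m i.hi := by
    rintro rfl
    simpa [simpleSwap_lo, simpleSwap_hi] using h
  simp only [LinearMap.comp_apply, LinearMap.add_apply, LinearMap.smul_apply, hcoord_ξ]
  rcases lt_trichotomy (m i.lo) (m i.hi) with hlt | heq | hgt
  · rw [actT_ξ_of_lt R q hlt, hcoord_ξ, if_neg fun hmk => hlt.not_gt (hm hmk)]
    simp only [comp_simpleSwap_eq_iff, smul_zero, add_zero]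
  · rw [actT_ξ_of_eq R q heq, map_smul, hcoord_ξ, if_neg fun hmk => (hm hmk).ne' heq,
      if_neg fun hmk => (hm_swap hmk).ne heq, smul_zero, smul_zero, add_zero]
  · rw [actT_ξ_of_gt R q hgt, map_add, map_smul, map_smul, hcoord_ξ, hcoord_ξ,
      if_neg fun hmk => hgt.not_gt (hm_swap (comp_simpleSwap_eq_iff.1 hmk)),
      if_neg fun hmk => hgt.not_gt (hm_swap hmk), smul_zero]

theorem repr_comp_simpleSwap {i : Adj r} {v : TSpace R n r} (h : actT R q i v = q • v)
    (k : Fin r → Fin n) : (ξ R).repr v (k ∘ simpleSwap i) = (ξ R).repr v k := by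
  have hgt : ∀ k : Fin r → Fin n, k i.hi < k i.lo →
      (ξ R).repr v (k ∘ simpleSwap i) = (ξ R).repr v k := by
    intro k hk
    have hrepr := repr_actT_of_gt R q hk v
    rw [h, map_smul, Finsupp.smul_apply, smul_eq_mul] at hrepr
    linear_combination -hrepr
  rcases lt_trichotomy (k i.lo) (k i.hi) with hk | hk | hk
  · have hswap := hgt (k ∘ simpleSwap i) (by simpa [simpleSwap_lo, simpleSwap_hi] using hk)
    rw [comp_simpleSwap_comp_simpleSwap] at hswap
    exact hswap.symm
  · rw [comp_simpleSwap_eq_self hk]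
  · exact hgt k hk

theorem actT_schur_gen (s : Schur R q n r) (l : WComp n r) {i : Adj r}
    (h : iword l i.lo = iword l i.hi) :
    actT R q i (permEquiv R q (s (gen R q l))) = q • permEquiv R q (s (gen R q l)) := by
  have hgen : MulOpposite.op (Hecke.T R q i) • gen R q l = q • gen R q l := by
    refine (permEquiv R q).injective ?_
    rw [map_smul, op_T_smul, permEquiv_smul, permEquiv_gen, actT_ξ_of_eq R q h]
  rw [← op_T_smul, ← map_smul, ← map_smul, hgen, LinearMap.map_smul_of_tower,
    permEquiv_smul]

theorem repr_schur_gen_eq (s : Schur R q n r) {l : WComp n r} {k k' : Fin r → Fin n}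
    (h : nmat k (iword l) = nmat k' (iword l)) :
    (ξ R).repr (permEquiv R q (s (gen R q l))) k =
      (ξ R).repr (permEquiv R q (s (gen R q l))) k' :=
  eq_of_nmat_eq (iword_monotone l)
    (fun _ k hi => repr_comp_simpleSwap R q (actT_schur_gen R q s l hi) k) h

/-- A word whose matrix relative to the increasing word of weight `co A` is `A`. -/
def repWord (A : NMat n r) : Fin r → Fin n := (exists_nmat_eq A).choose

theorem nmat_repWord (A : NMat n r) : nmat (repWord A) (iword (co A)) = A :=
  (exists_nmat_eq A).choose_spec

instance : Finite (NMat n r) :=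
  Finite.of_injective (fun A => (repWord A, co A)) fun A B h => by
    obtain ⟨hword, hco⟩ := Prod.mk.inj h
    rw [← nmat_repWord A, ← nmat_repWord B, hword, hco]

/-- The coordinates of an endomorphism with respect to the standard basis. -/
def schurCoord : Schur R q n r →ₗ[R] (NMat n r → R) :=
  LinearMap.pi fun A => (ξ R).coord (repWord A) ∘ₗ
    (permEquiv R q).toLinearMap.restrictScalars R ∘ₗ LinearMap.applyₗ' R (gen R q (co A))

theorem schurCoord_apply (s : Schur R q n r) (A : NMat n r) :
    schurCoord R q s A = (ξ R).repr (permEquiv R q (s (gen R q (co A)))) (repWord A) := rfl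

theorem schurCoord_std (A : NMat n r) : schurCoord R q (std R q A) = Pi.single A 1 := by
  funext B
  rw [schurCoord_apply, permEquiv_std_gen, Pi.single_apply]
  by_cases h : co B = co A
  · rw [if_pos h, repr_orb, ← h, nmat_repWord]
  · rw [if_neg h, if_neg fun hBA => h (congrArg co hBA), map_zero, Finsupp.zero_apply]

theorem schurCoord_injective : Function.Injective (schurCoord R q (n := n) (r := r)) := by
  refine fun s t hst => schur_ext fun l =>
    (permEquiv R q).injective ((ξ R).ext_elem fun k => ?_)
  have hco : co (nmat k (iword l)) = l := by rw [co_nmat, wt_iword]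
  have hrep : nmat k (iword l) = nmat (repWord (nmat k (iword l))) (iword l) := by
    conv_lhs => rw [← nmat_repWord (nmat k (iword l)), hco]
  have hcoord := congrFun hst (nmat k (iword l))
  rw [schurCoord_apply, schurCoord_apply, hco] at hcoord
  rw [repr_schur_gen_eq R q s hrep, repr_schur_gen_eq R q t hrep, hcoord]

theorem schurCoord_surjective : Function.Surjective (schurCoord R q (n := n) (r := r)) := by
  classical
  rw [← LinearMap.range_eq_top, eq_top_iff, ← (Pi.basisFun R (NMat n r)).span_eq,
    Submodule.span_le]
  rintro _ ⟨A, rfl⟩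
  refine ⟨std R q A, (schurCoord_std R q A).trans ?_⟩
  rw [Pi.basisFun_apply]

/-- The standard basis of the Schur algebra. -/
def stdBasis : Module.Basis (NMat n r) R (Schur R q n r) :=
  .ofEquivFun (LinearEquiv.ofBijective _ ⟨schurCoord_injective R q, schurCoord_surjective R q⟩)

theorem stdBasis_apply (A : NMat n r) : stdBasis R q A = std R q A := by
  classical
  rw [stdBasis, Module.Basis.coe_ofEquivFun, LinearEquiv.symm_apply_eq]
  exact (schurCoord_std R q A).symm

end Std

/-! ### The specialization isomorphism -/

section Theta

open Polynomial

variable {n r : ℕ}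

theorem specH_algebraMap (p : ℤ[X]) :
    specH (algebraMap ℤ[X] (Hecke ℤ[X] X r) p) = algebraMap ℂ (Hecke ℂ 0 r) (evZero p) := by
  unfold specH
  let _ : Algebra ℤ[X] (Hecke ℂ 0 r) :=
    ((algebraMap ℂ (Hecke ℂ 0 r)).comp evZero).toAlgebra' fun c x => Algebra.commutes (evZero c) x
  exact AlgHom.commutes (A := RingQuot (HeckeRel ℤ[X] X r)) _ p

theorem specH_Tw (w : Equiv.Perm (Fin r)) : specH (Hecke.Tw ℤ[X] X w) = Hecke.Tw ℂ 0 w := by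
  simp only [Hecke.Tw, map_list_prod, List.map_map, Function.comp_def, specH_T]

theorem specH_cosetSum (A : NMat n r) : specH (cosetSum ℤ[X] X A) = cosetSum ℂ 0 A := by
  simp only [cosetSum, map_sum, specH_Tw]

theorem coe_specM_apply (m : PermMod ℤ[X] X n r) (l : WComp n r) :
    ((specM m l : xH ℂ 0 l) : Hecke ℂ 0 r) = specH ((m l : xH ℤ[X] X l) : Hecke ℤ[X] X r) := by
  rw [specM, DirectSum.map_apply]
  rfl

theorem specM_gen (l : WComp n r) : specM (gen ℤ[X] X l) = gen ℂ 0 l := by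
  refine permMod_ext fun m => ?_
  rw [coe_specM_apply, coe_gen_apply, coe_gen_apply, apply_ite specH, specH_xsum, map_zero]

theorem specM_op_smul (h : (Hecke ℤ[X] X r)ᵐᵒᵖ) (m : PermMod ℤ[X] X n r) :
    specM (h • m) = MulOpposite.op (specH h.unop) • specM m := by
  refine permMod_ext fun l => ?_
  rw [coe_specM_apply]
  change specH (((m l : xH ℤ[X] X l) : Hecke ℤ[X] X r) * h.unop) =
    ((specM m l : xH ℂ 0 l) : Hecke ℂ 0 r) * specH h.unop
  rw [coe_specM_apply, map_mul]

theorem specM_smul (p : ℤ[X]) (m : PermMod ℤ[X] X n r) :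
    specM (p • m) = evZero p • specM m := by
  refine permMod_ext fun l => ?_
  rw [coe_specM_apply]
  change specH (p • ((m l : xH ℤ[X] X l) : Hecke ℤ[X] X r)) =
    evZero p • ((specM m l : xH ℂ 0 l) : Hecke ℂ 0 r)
  rw [coe_specM_apply, Algebra.smul_def, map_mul, specH_algebraMap, Algebra.smul_def]

theorem std_specM (A : NMat n r) (m : PermMod ℤ[X] X n r) :
    std ℂ 0 A (specM m) = specM (std ℤ[X] X A m) := by
  have hm : m ∈ Submodule.span (Hecke ℤ[X] X r)ᵐᵒᵖ (Set.range (gen ℤ[X] X (n := n) (r := r))) :=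
    span_gen ℤ[X] X ▸ Submodule.mem_top
  induction hm using Submodule.span_induction with
  | mem x hx =>
    obtain ⟨l, rfl⟩ := hx
    refine permMod_ext fun m => ?_
    rw [specM_gen, isStd_std ℂ 0 A l m, coe_specM_apply, isStd_std ℤ[X] X A l m,
      apply_ite specH, specH_cosetSum, map_zero]
  | zero => simp only [map_zero]
  | add x y _ _ hx hy => simp only [map_add, hx, hy]
  | smul h x _ hx => rw [specM_op_smul, map_smul, hx, map_smul, specM_op_smul]

/-- The specialization isomorphism as a linear map: it matches the standard bases. -/
def thetaLin : SchurZero n r ≃ₗ[ℂ] Schur ℂ 0 n r :=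
  (Algebra.TensorProduct.basis ℂ (stdBasis ℤ[X] X)).equiv (stdBasis ℂ 0) (Equiv.refl _)

theorem thetaLin_std (A : NMat n r) : thetaLin (1 ⊗ₜ std ℤ[X] X A) = std ℂ 0 A := by
  rw [← stdBasis_apply, ← stdBasis_apply, ← Algebra.TensorProduct.basis_apply, thetaLin,
    Module.Basis.equiv_apply, Equiv.refl_apply]

theorem thetaLin_specM (s : SchurQ n r) (m : PermMod ℤ[X] X n r) :
    thetaLin (1 ⊗ₜ s) (specM m) = specM (s m) := by
  induction (stdBasis ℤ[X] X).mem_span s using Submodule.span_induction with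
  | mem x hx =>
    obtain ⟨A, rfl⟩ := hx
    rw [stdBasis_apply, thetaLin_std, std_specM]
  | zero => simp only [TensorProduct.tmul_zero, map_zero, LinearMap.zero_apply]
  | add x y _ _ hx hy => simp only [TensorProduct.tmul_add, map_add, LinearMap.add_apply, hx, hy]
  | smul p x _ hx =>
    have hp : (1 : ℂ) ⊗ₜ[ℤ[X]] (p • x) = evZero p • ((1 : ℂ) ⊗ₜ[ℤ[X]] x) := by
      rw [← TensorProduct.smul_tmul, TensorProduct.smul_tmul', Algebra.smul_def, smul_eq_mul]
      rfl
    rw [hp, map_smul, LinearMap.smul_apply, hx, LinearMap.smul_apply, specM_smul]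

theorem thetaLin_tmul (c : ℂ) (s : SchurQ n r) : thetaLin (c ⊗ₜ s) = c • thetaLin (1 ⊗ₜ s) := by
  rw [← map_smul, TensorProduct.smul_tmul', smul_eq_mul, mul_one]

theorem thetaLin_one_tmul_mul (s t : SchurQ n r) :
    thetaLin (1 ⊗ₜ (s * t)) = thetaLin (1 ⊗ₜ s) * thetaLin (1 ⊗ₜ t) := by
  refine schur_ext fun l => ?_
  rw [← specM_gen, Module.End.mul_apply, thetaLin_specM, thetaLin_specM, thetaLin_specM,
    Module.End.mul_apply]

/-- The specialization isomorphism from the `0`-Schur algebra to the endomorphism algebra of the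
permutation module of the `0`-Hecke algebra. -/
def theta : SchurZero n r ≃ₐ[ℂ] Schur ℂ 0 n r :=
  Algebra.TensorProduct.algEquivOfLinearEquivTensorProduct thetaLin
    (fun c d s t => by
      rw [thetaLin_tmul, thetaLin_one_tmul_mul, thetaLin_tmul c, thetaLin_tmul d,
        smul_mul_smul_comm])
    (schur_ext fun l => by
      rw [← specM_gen, thetaLin_specM, Module.End.one_apply, Module.End.one_apply])

theorem theta_specM (s : SchurQ n r) (m : PermMod ℤ[X] X n r) :
    theta (1 ⊗ₜ s) (specM m) = specM (s m) := thetaLin_specM s m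

theorem theta_eA (A : NMat n r) : theta (eA A) = std ℂ 0 A := thetaLin_std A

end Theta

/-! ### The action of the degenerate quantum group on words -/

section Action

variable {n r : ℕ}

theorem ξ_apply (k : Fin r → Fin n) :
    ξ ℂ k = PiTensorProduct.tprod ℂ fun p => (Pi.single (k p) 1 : Fin n → ℂ) := by
  rw [ξ, Basis.piTensorProduct_apply]
  simp only [Pi.basisFun_apply]

/-- Appending the letter `a` to words, as a linear map `v ↦ v ⊗ ξ_a`. -/
def snocLin (a : Fin n) : TSpace ℂ n r →ₗ[ℂ] TSpace ℂ n (r + 1) :=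
  (snocEquiv n r).toLinearMap ∘ₗ (TensorProduct.mk ℂ _ _).flip (Pi.single a 1)

theorem snocLin_apply (a : Fin n) (v : TSpace ℂ n r) :
    snocLin a v = snocEquiv n r (v ⊗ₜ Pi.single a 1) := rfl

theorem snocLin_ξ (a : Fin n) (k : Fin r → Fin n) :
    snocLin a (ξ ℂ k) = ξ ℂ (Fin.snoc k a : Fin (r + 1) → Fin n) := by
  have hletter : (PiTensorProduct.subsingletonEquiv (R := ℂ)
      (s := fun _ : Fin 1 => (Fin n → ℂ)) 0).symm (Pi.single a 1) =
        PiTensorProduct.tprod ℂ fun _ => Pi.single a 1 := by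
    rw [LinearEquiv.symm_apply_eq, PiTensorProduct.subsingletonEquiv_apply_tprod]
  rw [snocLin_apply, snocEquiv, LinearEquiv.trans_apply, TensorProduct.congr_tmul,
    LinearEquiv.refl_apply, hletter, ξ_apply, ξ_apply, ← TensorPower.gMul_def,
    TensorPower.tprod_mul_tprod]
  congr 1
  funext p
  refine Fin.lastCases ?_ (fun p => ?_) p
  · rw [Fin.snoc_last]
    exact Fin.append_right _ _ 0
  · rw [Fin.snoc_castSucc]
    exact Fin.append_left _ _ p

theorem linearMap_ext_snocLin {M : Type*} [AddCommGroup M] [Module ℂ M]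
    {f g : TSpace ℂ n (r + 1) →ₗ[ℂ] M} (h : ∀ a v, f (snocLin a v) = g (snocLin a v)) : f = g :=
  (ξ ℂ).ext fun k => by
    rw [← Fin.snoc_init_self k, ← snocLin_ξ]
    exact h _ _

theorem linearMap_ext_snocLin₂ {M : Type*} [AddCommGroup M] [Module ℂ M]
    {f g : TSpace ℂ n (r + 2) →ₗ[ℂ] M}
    (h : ∀ b a v, f (snocLin b (snocLin a v)) = g (snocLin b (snocLin a v))) : f = g :=
  linearMap_ext_snocLin fun b => LinearMap.congr_fun
    (linearMap_ext_snocLin (f := f ∘ₗ snocLin b) (g := g ∘ₗ snocLin b) (h b))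

theorem rhoV_gen (g : UGen n) :
    rhoV (U0.mk (FreeAlgebra.ι ℂ g)) = Matrix.toLin' (rhoGen g) := by
  have hlift : RingQuot.liftAlgHom ℂ ⟨FreeAlgebra.lift ℂ rhoGen, lift_rhoGen_rel⟩
      (RingQuot.mkAlgHom ℂ (URel (n := n)) (FreeAlgebra.ι ℂ g)) = rhoGen g :=
    (RingQuot.liftAlgHom_mkAlgHom_apply ..).trans (FreeAlgebra.lift_ι_apply _ _)
  exact congrArg Matrix.toLin' hlift

theorem comul_gen (g : UGen n) : comul (U0.mk (FreeAlgebra.ι ℂ g)) = comulGen g :=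
  (RingQuot.liftAlgHom_mkAlgHom_apply ..).trans (FreeAlgebra.lift_ι_apply _ _)

theorem counit_gen (g : UGen n) : counit (U0.mk (FreeAlgebra.ι ℂ g)) = counitGen g :=
  (RingQuot.liftAlgHom_mkAlgHom_apply ..).trans (FreeAlgebra.lift_ι_apply _ _)

theorem single_mulVec_single (a b j : Fin n) :
    (Matrix.single a b (1 : ℂ)).mulVec (Pi.single j 1) =
      if j = b then (Pi.single a 1 : Fin n → ℂ) else 0 := by
  rw [Matrix.mulVec_single_one]
  funext i
  split_ifs with h
  · simp [Matrix.col_apply, Matrix.single_apply, Pi.single_apply, h, eq_comm]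
  · simp [Matrix.col_apply, Ne.symm h]

theorem rhoV_e (i : Adj n) (j : Fin n) :
    rhoV (U0.e i) (Pi.single j 1) = if j = i.hi then (Pi.single i.lo 1 : Fin n → ℂ) else 0 := by
  rw [U0.e, fe, rhoV_gen, Matrix.toLin'_apply, rhoGen, single_mulVec_single]

theorem rhoV_f (i : Adj n) (j : Fin n) :
    rhoV (U0.f i) (Pi.single j 1) = if j = i.lo then (Pi.single i.hi 1 : Fin n → ℂ) else 0 := by
  rw [U0.f, ff, rhoV_gen, Matrix.toLin'_apply, rhoGen, single_mulVec_single]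

theorem rhoV_k (i j : Fin n) :
    rhoV (U0.k i) (Pi.single j 1) = if j ≠ i then (Pi.single j 1 : Fin n → ℂ) else 0 := by
  rw [U0.k, fk, rhoV_gen, Matrix.toLin'_apply, rhoGen, Matrix.sum_mulVec]
  simp only [single_mulVec_single]
  rw [Finset.sum_ite_eq]
  simp

theorem rhoT_zero (u : U0 n) (v : TSpace ℂ n 0) : rhoT n 0 u v = counit u • v := rfl

theorem rhoT_snocLin (u : U0 n) (a : Fin n) (v : TSpace ℂ n r) :
    rhoT n (r + 1) u (snocLin a v) = snocEquiv n r
      (Module.endTensorEndAlgHom (R := ℂ) (S := ℂ) (A := ℂ)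
        (Algebra.TensorProduct.map (rhoT n r) rhoV (comul u)) (v ⊗ₜ Pi.single a 1)) := by
  have hconj : rhoT n (r + 1) u = (snocEquiv n r).conjAlgEquiv ℂ
      (Module.endTensorEndAlgHom (R := ℂ) (S := ℂ) (A := ℂ)
        (Algebra.TensorProduct.map (rhoT n r) rhoV (comul u))) := rfl
  rw [snocLin_apply, hconj, LinearEquiv.conjAlgEquiv_apply, LinearMap.comp_apply,
    LinearMap.comp_apply, LinearEquiv.coe_coe, LinearEquiv.coe_coe, LinearEquiv.symm_apply_apply]

theorem rhoT_k_snocLin (i a : Fin n) (v : TSpace ℂ n r) :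
    rhoT n (r + 1) (U0.k i) (snocLin a v) =
      if a ≠ i then snocLin a (rhoT n r (U0.k i) v) else 0 := by
  rw [rhoT_snocLin, U0.k, fk, comul_gen, comulGen, Algebra.TensorProduct.map_tmul,
    Module.endTensorEndAlgHom_apply, TensorProduct.AlgebraTensorModule.map_tmul, rhoV_k,
    TensorProduct.tmul_ite, apply_ite (snocEquiv n r), map_zero]
  rfl

theorem rhoT_e_snocLin (i : Adj n) (a : Fin n) (v : TSpace ℂ n r) :
    rhoT n (r + 1) (U0.e i) (snocLin a v) = (if a = i.hi then snocLin i.lo v else 0) +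
      if a ≠ i.lo then snocLin a (rhoT n r (U0.e i) v) else 0 := by
  rw [rhoT_snocLin, U0.e, fe, comul_gen, comulGen, map_add, map_add,
    Algebra.TensorProduct.map_tmul, Algebra.TensorProduct.map_tmul, LinearMap.add_apply,
    Module.endTensorEndAlgHom_apply, Module.endTensorEndAlgHom_apply,
    TensorProduct.AlgebraTensorModule.map_tmul, TensorProduct.AlgebraTensorModule.map_tmul,
    rhoV_k, rhoV_e, map_one, Module.End.one_apply, map_add, TensorProduct.tmul_ite,
    TensorProduct.tmul_ite, apply_ite (snocEquiv n r), apply_ite (snocEquiv n r), map_zero]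
  rfl

theorem rhoT_f_snocLin (i : Adj n) (a : Fin n) (v : TSpace ℂ n r) :
    rhoT n (r + 1) (U0.f i) (snocLin a v) =
      (if a = i.lo then snocLin i.hi (rhoT n r (U0.k i.hi) v) else 0) +
        snocLin a (rhoT n r (U0.f i) v) := by
  rw [rhoT_snocLin, U0.f, ff, comul_gen, comulGen, map_add, map_add,
    Algebra.TensorProduct.map_tmul, Algebra.TensorProduct.map_tmul, LinearMap.add_apply,
    Module.endTensorEndAlgHom_apply, Module.endTensorEndAlgHom_apply,
    TensorProduct.AlgebraTensorModule.map_tmul, TensorProduct.AlgebraTensorModule.map_tmul,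
    rhoV_f, map_one, Module.End.one_apply, map_add, TensorProduct.tmul_ite,
    apply_ite (snocEquiv n r), map_zero]
  rfl

theorem rhoT_k_ξ (i : Fin n) (k : Fin r → Fin n) :
    rhoT n r (U0.k i) (ξ ℂ k) = if ∀ p, k p ≠ i then ξ ℂ k else 0 := by
  induction r with
  | zero =>
    rw [rhoT_zero, U0.k, fk, counit_gen, counitGen, one_smul, if_pos fun p => p.elim0]
  | succ r ih =>
    cases k using Fin.snocCases with | snoc k a
    rw [← snocLin_ξ, rhoT_k_snocLin, ih, apply_ite (snocLin a), map_zero, ← ite_and]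
    simp only [Fin.forall_fin_succ', Fin.snoc_castSucc, Fin.snoc_last, and_comm]

theorem rhoT_e_ξ (i : Adj n) (k : Fin r → Fin n) :
    rhoT n r (U0.e i) (ξ ℂ k) = ∑ p, if k p = i.hi ∧ ∀ p', p < p' → k p' ≠ i.lo then
      ξ ℂ (Function.update k p i.lo) else 0 := by
  induction r with
  | zero =>
    rw [rhoT_zero, U0.e, fe, counit_gen, counitGen, zero_smul, Fin.sum_univ_zero]
  | succ r ih =>
    cases k using Fin.snocCases with | snoc k a
    rw [← snocLin_ξ, rhoT_e_snocLin, ih, Fin.sum_univ_castSucc, snocLin_ξ, map_sum,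
      add_comm (ite _ _ _)]
    simp only [Fin.forall_fin_succ', Fin.snoc_castSucc, Fin.snoc_last, Fin.castSucc_lt_castSucc_iff,
      Fin.castSucc_lt_last, forall_const, apply_ite (snocLin a), map_zero, snocLin_ξ,
      ← Fin.snoc_update, Fin.update_snoc_last, (Fin.le_last _).not_gt, false_implies, and_true]
    by_cases ha : a = i.lo <;> simp [ha]

theorem rhoT_f_ξ (i : Adj n) (k : Fin r → Fin n) :
    rhoT n r (U0.f i) (ξ ℂ k) = ∑ p, if k p = i.lo ∧ ∀ p', p' < p → k p' ≠ i.hi then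
      ξ ℂ (Function.update k p i.hi) else 0 := by
  induction r with
  | zero =>
    rw [rhoT_zero, U0.f, ff, counit_gen, counitGen, zero_smul, Fin.sum_univ_zero]
  | succ r ih =>
    cases k using Fin.snocCases with | snoc k a
    rw [← snocLin_ξ, rhoT_f_snocLin, ih, rhoT_k_ξ, Fin.sum_univ_castSucc, map_sum,
      add_comm (ite _ _ _)]
    simp only [Fin.forall_fin_succ', Fin.snoc_castSucc, Fin.snoc_last, Fin.castSucc_lt_castSucc_iff,
      Fin.castSucc_lt_last, forall_const, apply_ite (snocLin _), map_zero, snocLin_ξ,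
      ← Fin.snoc_update, Fin.update_snoc_last, (Fin.castSucc_lt_last _).not_gt, lt_irrefl,
      false_implies, and_true, ite_and]

end Action

/-! ### The two actions commute -/

section Commute

variable {n r : ℕ}

/-- The pair of adjacent positions `j`, `j + 1` of a word of length `r`, in a longer word. -/
def Adj.castSucc (j : Adj r) : Adj (r + 1) := ⟨j.1, Nat.lt_succ_of_lt j.2⟩

/-- The last pair of adjacent positions. -/
def Adj.last (r : ℕ) : Adj (r + 2) := ⟨r, Nat.lt_succ_self _⟩

theorem Adj.last_lo (r : ℕ) : (Adj.last r).lo = (Fin.last r).castSucc := rfl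

theorem Adj.last_hi (r : ℕ) : (Adj.last r).hi = Fin.last (r + 1) := rfl

@[elab_as_elim]
theorem Adj.snocInduction {P : ∀ {r : ℕ}, Adj r → Prop}
    (castSucc : ∀ {r : ℕ} (j : Adj r), P j → P j.castSucc) (last : ∀ r, P (Adj.last r))
    (j : Adj r) : P j := by
  induction r with
  | zero => exact absurd j.2 (Nat.not_lt_zero _)
  | succ r ih =>
    obtain ⟨m, hm⟩ := j
    rcases Nat.lt_succ_iff_lt_or_eq.1 hm with h | rfl
    · exact castSucc ⟨m, h⟩ (ih ⟨m, h⟩)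
    · exact last m

theorem actT_zero_ξ (j : Adj r) (k : Fin r → Fin n) : actT ℂ 0 j (ξ ℂ k) =
    if k j.lo < k j.hi then ξ ℂ (k ∘ simpleSwap j)
    else if k j.lo = k j.hi then 0 else -ξ ℂ k := by
  rcases lt_trichotomy (k j.lo) (k j.hi) with h | h | h
  · rw [actT_ξ_of_lt ℂ 0 h, if_pos h]
  · rw [actT_ξ_of_eq ℂ 0 h, if_neg h.not_lt, if_pos h, zero_smul]
  · rw [actT_ξ_of_gt ℂ 0 h, if_neg h.not_gt, if_neg h.ne', zero_smul, zero_add, zero_sub]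
    exact neg_one_smul ℂ (ξ ℂ k)

theorem snoc_comp_simpleSwap_castSucc {α : Type*} (k : Fin r → α) (a : α) (j : Adj r) :
    (Fin.snoc k a : Fin (r + 1) → α) ∘ simpleSwap j.castSucc = Fin.snoc (k ∘ simpleSwap j) a := by
  funext p
  refine Fin.lastCases ?_ (fun p => ?_) p
  · rw [Function.comp_apply, simpleSwap_of_ne, Fin.snoc_last, Fin.snoc_last]
    · exact (Fin.castSucc_lt_last j.lo).ne'
    · exact (Fin.castSucc_lt_last j.hi).ne'
  · have hswap : simpleSwap j.castSucc p.castSucc = (simpleSwap j p).castSucc :=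
      (Fin.castSucc_injective r).swap_apply j.lo j.hi p
    rw [Function.comp_apply, hswap, Fin.snoc_castSucc, Fin.snoc_castSucc, Function.comp_apply]

theorem snoc_snoc_comp_simpleSwap_last {α : Type*} (k : Fin r → α) (a b : α) :
    (Fin.snoc (Fin.snoc k a : Fin (r + 1) → α) b : Fin (r + 2) → α) ∘ simpleSwap (Adj.last r) =
      Fin.snoc (Fin.snoc k b : Fin (r + 1) → α) a := by
  refine comp_simpleSwap_eq_iff.2 (funext fun p => ?_)
  refine Fin.lastCases ?_ (Fin.lastCases ?_ fun p => ?_) p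
  · rw [← Adj.last_hi, Function.comp_apply, simpleSwap_hi, Adj.last_hi, Adj.last_lo]
    simp
  · rw [← Adj.last_lo, Function.comp_apply, simpleSwap_lo, Adj.last_hi, Adj.last_lo]
    simp
  · rw [Function.comp_apply, simpleSwap_of_ne]
    · simp
    · exact (Fin.castSucc_injective _).ne (Fin.castSucc_lt_last p).ne
    · exact (Fin.castSucc_lt_last p.castSucc).ne

theorem actT_castSucc_snocLin (j : Adj r) (a : Fin n) (v : TSpace ℂ n r) :
    actT ℂ 0 j.castSucc (snocLin a v) = snocLin a (actT ℂ 0 j v) := by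
  suffices hcomp : actT ℂ 0 j.castSucc ∘ₗ snocLin a = snocLin a ∘ₗ actT ℂ 0 j from
    LinearMap.congr_fun hcomp v
  refine (ξ ℂ).ext fun k => ?_
  have hlo : (Fin.snoc k a : Fin (r + 1) → Fin n) j.castSucc.lo = k j.lo :=
    Fin.snoc_castSucc (α := fun _ => Fin n) a k j.lo
  have hhi : (Fin.snoc k a : Fin (r + 1) → Fin n) j.castSucc.hi = k j.hi :=
    Fin.snoc_castSucc (α := fun _ => Fin n) a k j.hi
  rw [LinearMap.comp_apply, LinearMap.comp_apply, snocLin_ξ, actT_zero_ξ, actT_zero_ξ,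
    apply_ite (snocLin a), apply_ite (snocLin a), map_zero, map_neg, snocLin_ξ, snocLin_ξ, hlo, hhi,
    snoc_comp_simpleSwap_castSucc]

theorem actT_last_snocLin_snocLin (a b : Fin n) (v : TSpace ℂ n r) :
    actT ℂ 0 (Adj.last r) (snocLin b (snocLin a v)) =
      if a < b then snocLin a (snocLin b v)
      else if a = b then 0 else -snocLin b (snocLin a v) := by
  let rhs : TSpace ℂ n r →ₗ[ℂ] TSpace ℂ n (r + 2) :=
    if a < b then snocLin a ∘ₗ snocLin b else if a = b then 0 else -(snocLin b ∘ₗ snocLin a)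
  suffices hcomp : actT ℂ 0 (Adj.last r) ∘ₗ snocLin b ∘ₗ snocLin a = rhs by
    refine (LinearMap.congr_fun hcomp v).trans ?_
    simp only [rhs]
    split_ifs <;> rfl
  refine (ξ ℂ).ext fun k => ?_
  have hlo : (Fin.snoc (Fin.snoc k a : Fin (r + 1) → Fin n) b : Fin (r + 2) → Fin n)
      (Adj.last r).lo = a := by
    rw [Adj.last_lo, Fin.snoc_castSucc, Fin.snoc_last]
  have hhi : (Fin.snoc (Fin.snoc k a : Fin (r + 1) → Fin n) b : Fin (r + 2) → Fin n)
      (Adj.last r).hi = b := by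
    rw [Adj.last_hi, Fin.snoc_last]
  rw [LinearMap.comp_apply, LinearMap.comp_apply, snocLin_ξ, snocLin_ξ, actT_zero_ξ, hlo, hhi,
    snoc_snoc_comp_simpleSwap_last]
  simp only [rhs]
  split_ifs <;> simp [snocLin_ξ]

theorem commute_rhoT_k (i : Fin n) (j : Adj r) :
    Commute (rhoT n r (U0.k i)) (actT ℂ 0 j) := by
  induction j using Adj.snocInduction with
  | castSucc j ih =>
    refine linearMap_ext_snocLin fun a v => ?_
    have ihv := LinearMap.congr_fun ih.eq v
    simp only [Module.End.mul_apply] at ihv ⊢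
    rw [actT_castSucc_snocLin, rhoT_k_snocLin, rhoT_k_snocLin, ihv, apply_ite (actT ℂ 0 _),
      actT_castSucc_snocLin, map_zero]
  | last r =>
    refine linearMap_ext_snocLin₂ fun b a v => ?_
    simp only [Module.End.mul_apply, actT_last_snocLin_snocLin, rhoT_k_snocLin, map_zero,
      apply_ite (rhoT n (r + 2) (U0.k i)), apply_ite (snocLin (n := n) (r := r + 1) _),
      apply_ite (actT ℂ 0 (Adj.last r)), map_neg]
    grind

theorem commute_rhoT_e (i : Adj n) (j : Adj r) :
    Commute (rhoT n r (U0.e i)) (actT ℂ 0 j) := by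
  induction j using Adj.snocInduction with
  | castSucc j ih =>
    refine linearMap_ext_snocLin fun a v => ?_
    have ihv := LinearMap.congr_fun ih.eq v
    simp only [Module.End.mul_apply] at ihv ⊢
    rw [actT_castSucc_snocLin, rhoT_e_snocLin, rhoT_e_snocLin, ihv, map_add,
      apply_ite (actT ℂ 0 _), apply_ite (actT ℂ 0 _),
      actT_castSucc_snocLin, actT_castSucc_snocLin, map_zero]
  | last r =>
    refine linearMap_ext_snocLin₂ fun b a v => ?_
    have hi : i.hi.1 = i.lo.1 + 1 := rfl
    simp only [Module.End.mul_apply, actT_last_snocLin_snocLin, rhoT_e_snocLin, map_zero,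
      apply_ite (rhoT n (r + 2) (U0.e i)), apply_ite (snocLin (n := n) (r := r + 1) _),
      apply_ite (actT ℂ 0 (Adj.last r)), map_neg, map_add]
    grind

theorem commute_rhoT_f (i : Adj n) (j : Adj r) :
    Commute (rhoT n r (U0.f i)) (actT ℂ 0 j) := by
  induction j using Adj.snocInduction with
  | castSucc j ih =>
    refine linearMap_ext_snocLin fun a v => ?_
    have ihv := LinearMap.congr_fun ih.eq v
    have hk := LinearMap.congr_fun (commute_rhoT_k i.hi j).eq v
    simp only [Module.End.mul_apply] at ihv hk ⊢
    rw [actT_castSucc_snocLin, rhoT_f_snocLin, rhoT_f_snocLin, ihv, hk, map_add,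
      apply_ite (actT ℂ 0 _), actT_castSucc_snocLin, actT_castSucc_snocLin, map_zero]
  | last r =>
    refine linearMap_ext_snocLin₂ fun b a v => ?_
    have hi : i.hi.1 = i.lo.1 + 1 := rfl
    simp only [Module.End.mul_apply, actT_last_snocLin_snocLin, rhoT_f_snocLin, rhoT_k_snocLin,
      map_zero, apply_ite (rhoT n (r + 2) (U0.f i)), apply_ite (snocLin (n := n) (r := r + 1) _),
      apply_ite (actT ℂ 0 (Adj.last r)), map_neg, map_add]
    grind

theorem U0.induction {P : U0 n → Prop} (algebraMap : ∀ c : ℂ, P (algebraMap ℂ _ c))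
    (e : ∀ i, P (U0.e i)) (f : ∀ i, P (U0.f i)) (k : ∀ i, P (U0.k i))
    (mul : ∀ x y, P x → P y → P (x * y)) (add : ∀ x y, P x → P y → P (x + y)) (u : U0 n) :
    P u := by
  obtain ⟨y, rfl⟩ := RingQuot.mkAlgHom_surjective ℂ (URel (n := n)) u
  induction y using FreeAlgebra.induction with
  | grade0 c =>
    rw [AlgHom.commutes]
    exact algebraMap c
  | grade1 g =>
    cases g with
    | e i => exact e i
    | f i => exact f i
    | k i => exact k i
  | mul a b ha hb =>
    rw [map_mul]
    exact mul _ _ ha hb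
  | add a b ha hb =>
    rw [map_add]
    exact add _ _ ha hb

theorem commute_rhoT (u : U0 n) (j : Adj r) : Commute (rhoT n r u) (actT ℂ 0 j) := by
  induction u using U0.induction with
  | algebraMap c =>
    rw [AlgHom.commutes]
    exact Algebra.commute_algebraMap_left c _
  | e i => exact commute_rhoT_e i j
  | f i => exact commute_rhoT_f i j
  | k i => exact commute_rhoT_k i j
  | mul x y hx hy =>
    rw [map_mul]
    exact hx.mul_left hy
  | add x y hx hy =>
    rw [map_add]
    exact hx.add_left hy

end Commute

section Psi

variable {n r : ℕ}

variable (n r) in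
/-- The action of `U_0(gl_n)` on the tensor space, as an algebra homomorphism into the endomorphism
algebra of this right module over the `0`-Hecke algebra. -/
def rhoH : U0 n →ₐ[ℂ] Module.End (Hecke ℂ 0 r)ᵐᵒᵖ (TSpace ℂ n r) :=
  AlgHom.ofLinearMap
    { toFun := fun u => heckeLinearMap (rhoT n r u) fun i v => by
        rw [op_T_smul, op_T_smul]
        exact LinearMap.congr_fun (commute_rhoT u i).eq v
      map_add' := fun u u' => LinearMap.ext fun v => LinearMap.congr_fun (map_add _ u u') v
      map_smul' := fun c u => LinearMap.ext fun v => LinearMap.congr_fun (map_smul _ c u) v }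
    (LinearMap.ext fun v => LinearMap.congr_fun (map_one (rhoT n r)) v)
    fun u u' => LinearMap.ext fun v => LinearMap.congr_fun (map_mul (rhoT n r) u u') v

variable (n r) in
/-- The action of `U_0(gl_n)` on the permutation module of the `0`-Hecke algebra that corresponds to
its action on the tensor space. -/
def psiEnd : U0 n →ₐ[ℂ] Schur ℂ 0 n r :=
  ((permEquiv ℂ 0).symm.conjAlgEquiv ℂ).toAlgHom.comp (rhoH n r)

theorem permEquiv_psiEnd (u : U0 n) (m : PermMod ℂ 0 n r) :
    permEquiv ℂ 0 (psiEnd n r u m) = rhoT n r u (permEquiv ℂ 0 m) :=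
  (permEquiv ℂ 0).apply_symm_apply _

end Psi

/-! ### The images of the generators -/

section Images

variable {n r : ℕ}

theorem nmat_self (m : Fin r → Fin n) : (nmat m m).1 = Matrix.diagonal (wt m).1 := by
  ext i j
  rw [Matrix.diagonal_apply, nmat_apply]
  split_ifs with h
  · subst h
    simp [wt, letterCount]
  · rw [← Nat.pos_iff_ne_zero.not_left, letterCount_pos]
    rintro ⟨p, hp⟩
    rw [Prod.mk.injEq] at hp
    exact h (hp.1.symm.trans hp.2)

theorem letterCount_update_add {ι β : Type*} [Fintype ι] [DecidableEq ι] [DecidableEq β]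
    (k : ι → β) (p : ι) (a b : β) :
    letterCount (Function.update k p a) b + (if k p = b then 1 else 0) =
      letterCount k b + if a = b then 1 else 0 := by
  simp only [letterCount, Finset.card_filter]
  rw [← Finset.add_sum_erase _ _ (Finset.mem_univ p),
    ← Finset.add_sum_erase _ (fun x => if k x = b then 1 else 0) (Finset.mem_univ p),
    Function.update_self, Finset.sum_congr rfl fun x hx => by
      rw [Function.update_of_ne (Finset.ne_of_mem_erase hx)]]
  ring

theorem nmat_update_add (k m : Fin r → Fin n) (p : Fin r) (a : Fin n) :
    (nmat (Function.update k p a) m).1 + Matrix.single (k p) (m p) 1 =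
      (nmat k m).1 + Matrix.single a (m p) 1 := by
  have hupdate : (fun x => (Function.update k p a x, m x)) =
      Function.update (fun x => (k x, m x)) p (a, m p) := by
    funext x
    rcases eq_or_ne x p with rfl | hx
    · rw [Function.update_self, Function.update_self]
    · rw [Function.update_of_ne hx, Function.update_of_ne hx]
  ext i j
  rw [Matrix.add_apply, Matrix.add_apply, nmat_apply, nmat_apply, hupdate, Matrix.single_apply,
    Matrix.single_apply]
  simpa only [Prod.mk.injEq] using
    letterCount_update_add (fun x => (k x, m x)) p (a, m p) (i, j)

theorem moved_add (l : WComp n r) (a b : Fin n) (h : 0 < l.1 b) :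
    (moved l a b h).1 + Matrix.single b b 1 = Matrix.diagonal l.1 + Matrix.single a b 1 := by
  ext i j
  have hle : (Matrix.single b b 1 : Matrix (Fin n) (Fin n) ℕ) i j ≤ Matrix.diagonal l.1 i j := by
    rw [Matrix.single_apply]
    split_ifs with hij
    · obtain ⟨rfl, rfl⟩ := hij
      rw [Matrix.diagonal_apply_eq]
      exact h
    · exact Nat.zero_le _
  simp only [moved, Matrix.add_apply, Matrix.sub_apply]
  omega

theorem exists_iword_eq {l : WComp n r} {b : Fin n} : (∃ p, iword l p = b) ↔ 0 < l.1 b := by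
  rw [← letterCount_pos]
  exact iff_of_eq (congrArg (fun m : WComp n r => 0 < m.1 b) (wt_iword l))

theorem nmat_update_iword {l : WComp n r} {p : Fin r} {b : Fin n} (hp : iword l p = b) (a : Fin n)
    (h : 0 < l.1 b) : nmat (Function.update (iword l) p a) (iword l) = moved l a b h := by
  refine Subtype.ext (add_right_cancel (b := Matrix.single b b 1) ?_)
  have hupdate := nmat_update_add (iword l) (iword l) p a
  rwa [hp, nmat_self, wt_iword, ← moved_add l a b h] at hupdate

theorem co_moved (l : WComp n r) (a b : Fin n) (h : 0 < l.1 b) : co (moved l a b h) = l := by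
  obtain ⟨p, hp⟩ := exists_iword_eq.2 h
  rw [← nmat_update_iword hp, co_nmat, wt_iword]

theorem exists_update_iword_of_nmat_eq {l : WComp n r} {a b : Fin n} (hab : a ≠ b) {h : 0 < l.1 b}
    {k : Fin r → Fin n} (hk : nmat k (iword l) = moved l a b h) :
    ∃ p, iword l p = b ∧ Function.update (iword l) p a = k := by
  have hoff : ∀ i j, i ≠ j → letterCount (fun p => (k p, iword l p)) (i, j) =
      if a = i ∧ b = j then 1 else 0 := by
    intro i j hij
    have hentry := congrFun (congrFun (moved_add l a b h) i) j
    rw [← hk, Matrix.add_apply, Matrix.add_apply, Matrix.diagonal_apply_ne _ hij,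
      Matrix.single_apply, Matrix.single_apply, if_neg fun hb => hij (hb.1.symm.trans hb.2),
      add_zero, zero_add] at hentry
    exact hentry
  have hone := hoff a b hab
  rw [if_pos ⟨rfl, rfl⟩, letterCount, Finset.card_eq_one] at hone
  obtain ⟨p, hp⟩ := hone
  have hmem : ∀ x, (k x, iword l x) = (a, b) ↔ x = p := fun x => by
    rw [← Finset.mem_singleton (b := x), ← hp, Finset.mem_filter, and_iff_right (Finset.mem_univ x)]
  obtain ⟨hkp, hlp⟩ := Prod.mk.inj ((hmem p).2 rfl)
  refine ⟨p, hlp, Function.update_eq_iff.2 ⟨hkp.symm, fun x hx => ?_⟩⟩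
  by_contra hne
  have hpos : 0 < letterCount (fun p => (k p, iword l p)) (k x, iword l x) :=
    letterCount_pos.2 ⟨x, rfl⟩
  rw [hoff _ _ (Ne.symm hne)] at hpos
  split_ifs at hpos with hx'
  · exact hx ((hmem x).1 (Prod.ext hx'.1.symm hx'.2.symm))
  · exact hpos.false

theorem orb_moved (l : WComp n r) {a b : Fin n} (hab : a ≠ b) (h : 0 < l.1 b) :
    orb ℂ (moved l a b h) =
      ∑ p, if iword l p = b then ξ ℂ (Function.update (iword l) p a) else 0 := by
  rw [← Finset.sum_filter, orb, co_moved]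
  symm
  refine Finset.sum_bij (fun p _ => Function.update (iword l) p a) ?_ ?_ ?_ fun _ _ => rfl
  · intro p hp
    exact Finset.mem_filter.2 ⟨Finset.mem_univ _, nmat_update_iword (Finset.mem_filter.1 hp).2 a h⟩
  · intro p hp p' _ heq
    by_contra hne
    have hap := congrFun heq p
    rw [Function.update_self, Function.update_of_ne hne, (Finset.mem_filter.1 hp).2] at hap
    exact hab hap
  · intro k hk
    obtain ⟨p, hp, heq⟩ := exists_update_iword_of_nmat_eq hab (Finset.mem_filter.1 hk).2
    exact ⟨p, Finset.mem_filter.2 ⟨Finset.mem_univ _, hp⟩, heq⟩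

theorem permEquiv_sum_moved_gen (l : WComp n r) {a b : Fin n} (hab : a ≠ b) :
    permEquiv ℂ 0 (theta (∑ m : WComp n r, if h : 0 < m.1 b then eA (moved m a b h) else 0)
      (gen ℂ 0 l)) = ∑ p, if iword l p = b then ξ ℂ (Function.update (iword l) p a) else 0 := by
  have hterm : ∀ m : WComp n r,
      permEquiv ℂ 0 (theta (if h : 0 < m.1 b then eA (moved m a b h) else 0) (gen ℂ 0 l)) =
        if l = m then ∑ p, if iword l p = b then ξ ℂ (Function.update (iword l) p a) else 0
        else 0 := by
    intro m
    by_cases h : 0 < m.1 b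
    · rw [dif_pos h, theta_eA, permEquiv_std_gen, co_moved]
      exact ite_congr rfl (fun hm => by subst hm; exact orb_moved l hab h) fun _ => rfl
    · rw [dif_neg h, map_zero, LinearMap.zero_apply, map_zero, eq_comm]
      refine ite_eq_right_iff.2 fun hm => Finset.sum_eq_zero fun p _ => if_neg fun hp => ?_
      subst hm
      exact h (exists_iword_eq.1 ⟨p, hp⟩)
  rw [map_sum, LinearMap.sum_apply, map_sum, Finset.sum_congr rfl fun m _ => hterm m,
    Finset.sum_ite_eq, if_pos (Finset.mem_univ l)]

theorem psiEnd_e (i : Adj n) : psiEnd n r (U0.e i) = theta (eS i) := by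
  refine schur_ext fun l => (permEquiv ℂ 0).injective ?_
  rw [permEquiv_psiEnd, permEquiv_gen, eS, permEquiv_sum_moved_gen l i.lo_lt_hi.ne, rhoT_e_ξ]
  refine Finset.sum_congr rfl fun p _ => if_congr ?_ rfl rfl
  refine and_iff_left_of_imp fun hp p' hlt hp' => ?_
  have hle := iword_monotone l hlt.le
  rw [hp, hp'] at hle
  exact hle.not_gt i.lo_lt_hi

theorem psiEnd_f (i : Adj n) : psiEnd n r (U0.f i) = theta (fS i) := by
  refine schur_ext fun l => (permEquiv ℂ 0).injective ?_
  rw [permEquiv_psiEnd, permEquiv_gen, fS, permEquiv_sum_moved_gen l i.lo_lt_hi.ne', rhoT_f_ξ]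
  refine Finset.sum_congr rfl fun p _ => if_congr ?_ rfl rfl
  refine and_iff_left_of_imp fun hp p' hlt hp' => ?_
  have hle := iword_monotone l hlt.le
  rw [hp, hp'] at hle
  exact hle.not_gt i.lo_lt_hi

theorem nmat_eq_nmat_self_iff {k m : Fin r → Fin n} : nmat k m = nmat m m ↔ k = m := by
  refine ⟨fun h => funext fun p => ?_, fun h => h ▸ rfl⟩
  have hpos : 0 < (nmat k m).1 (k p) (m p) := letterCount_pos.2 ⟨p, rfl⟩
  rw [h, nmat_apply, letterCount_pos] at hpos
  obtain ⟨p', hp'⟩ := hpos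
  obtain ⟨hk, hm⟩ := Prod.mk.inj hp'
  exact hk.symm.trans hm

theorem orb_nmat_self_iword (l : WComp n r) : orb ℂ (nmat (iword l) (iword l)) = ξ ℂ (iword l) := by
  rw [orb, co_nmat, wt_iword]
  simp only [nmat_eq_nmat_self_iff]
  rw [Finset.filter_eq', if_pos (Finset.mem_univ _), Finset.sum_singleton]

theorem kS_eq_eA_nmat_self (l : WComp n r) : kS l = eA (nmat (iword l) (iword l)) :=
  congrArg eA (Subtype.ext (by rw [nmat_self, wt_iword]))

theorem permEquiv_kS_gen (m l : WComp n r) :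
    permEquiv ℂ 0 (theta (kS m) (gen ℂ 0 l)) = if l = m then ξ ℂ (iword l) else 0 := by
  rw [kS_eq_eA_nmat_self, theta_eA, permEquiv_std_gen, co_nmat, wt_iword, orb_nmat_self_iword]
  exact ite_congr rfl (fun hlm => by rw [hlm]) fun _ => rfl

theorem psiEnd_k (i : Fin n) : psiEnd n r (U0.k i) =
    theta (∑ m ∈ Finset.univ.filter (fun m : WComp n r => m.1 i = 0), kS m) := by
  refine schur_ext fun l => (permEquiv ℂ 0).injective ?_
  rw [permEquiv_psiEnd, permEquiv_gen, rhoT_k_ξ, map_sum, LinearMap.sum_apply, map_sum,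
    Finset.sum_congr rfl fun m _ => permEquiv_kS_gen m l, Finset.sum_ite_eq]
  refine if_congr ?_ rfl rfl
  rw [Finset.mem_filter, and_iff_right (Finset.mem_univ l), ← not_exists, exists_iword_eq,
    Nat.pos_iff_ne_zero, not_not]

variable (n r) in
/-- The homomorphism `ψ_{n,r}` from `U_0(gl_n)` to the `0`-Schur algebra. -/
def psi : U0 n →ₐ[ℂ] SchurZero n r :=
  (AlgEquiv.symm theta).toAlgHom.comp (psiEnd n r)

theorem theta_psi (u : U0 n) : theta (psi n r u) = psiEnd n r u := theta.apply_symm_apply _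

theorem permEquiv_theta_psi (u : U0 n) (m : PermMod ℂ 0 n r) :
    permEquiv ℂ 0 (theta (psi n r u) m) = rhoT n r u (permEquiv ℂ 0 m) := by
  rw [theta_psi, permEquiv_psiEnd]

theorem psi_e (i : Adj n) : psi n r (U0.e i) = eS i :=
  theta.injective ((theta_psi _).trans (psiEnd_e i))

theorem psi_f (i : Adj n) : psi n r (U0.f i) = fS i :=
  theta.injective ((theta_psi _).trans (psiEnd_f i))

theorem psi_k (i : Fin n) : psi n r (U0.k i) =
    ∑ m ∈ Finset.univ.filter (fun m : WComp n r => m.1 i = 0), kS m :=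
  theta.injective ((theta_psi _).trans (psiEnd_k i))

end Images

end ZeroSchur

end

open ZeroSchur Polynomial in
/-- `Θ` is the specialization isomorphism from the `0`-Schur algebra to the endomorphism algebra of
`⨁ x_l H` for the `0`-Hecke algebra `H`, `φ₀` is the isomorphism of this module with the tensor
space, and `ψ` corresponds to the action of `U_0(gl_n)` on the tensor space. Each is determined by
its condition (the first three conditions below), since the elements `gen l` generate `⨁ x_l H`. -/
theorem mainTheorem9 (n r : ℕ) :
    (∀ A : NMat n r, IsStd ℤ[X] X A (std ℤ[X] X A)) ∧
    ∃ (φ₀ : PermMod ℂ 0 n r ≃ₗ[(Hecke ℂ 0 r)ᵐᵒᵖ] TSpace ℂ n r)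
      (Θ : SchurZero n r ≃ₐ[ℂ] Schur ℂ 0 n r)
      (ψ : U0 n →ₐ[ℂ] SchurZero n r),
      (∀ l : WComp n r, φ₀ (gen ℂ 0 l) = ξ ℂ (iword l)) ∧
      (∀ (s : SchurQ n r) (m : PermMod ℤ[X] X n r), Θ (1 ⊗ₜ s) (specM m) = specM (s m)) ∧
      (∀ (u : U0 n) (m : PermMod ℂ 0 n r), φ₀ (Θ (ψ u) m) = rhoT n r u (φ₀ m)) ∧
      (∀ i : Adj n, ψ (U0.e i) = eS i) ∧
      (∀ i : Adj n, ψ (U0.f i) = fS i) ∧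
      (∀ i : Fin n, ψ (U0.k i) = ∑ μ ∈ Finset.univ.filter (fun μ : WComp n r => μ.1 i = 0), kS μ) := by
  exact ⟨isStd_std ℤ[X] X, permEquiv ℂ 0, theta, psi n r, permEquiv_gen ℂ 0, theta_specM,
    permEquiv_theta_psi, psi_e, psi_f, psi_k⟩
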